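/- Let $r\ge 3$ be an integer. For $p_0\in(0,1)$ consider the system of differential equations on $[0,\infty)$ $$w'=-rs,\qquad b'=-b-rt+rs,\qquad q'=-\frac{(2r-2)qs}{w},$$ $$s'=-s+\frac{(r-1)qs}{w}-\frac{(r-1)s^2}{w}-\frac{r(r-2)st}{(r-1)b},\qquad t'=-2t+\frac{2(r-1)s^2}{w}-\frac{2r(r-2)t^2}{(r-1)b},$$ with initial conditions $w(0)=(1-p_0)^{r+1}$, $b(0)=rp_0(1-p_0)^r$, $q(0)=(1-p_0)^{2r}$, $s(0)=(r-1)p_0(1-p_0)^{2r-1}$, $t(0)=(r-1)^2p_0^2(1-p_0)^{2r-2}$. For its positive solution put $$\xi(r,p_0)=p_0(1-p_0)^r+\int_0^\infty b(x)\,dx+\begin{cases}\lim_{x\to\infty}w(x)&\text{if }\lim_{x\to\infty}\frac{(r-1)q(x)}{w(x)}<1,\\0&\text{otherwise,}\end{cases}$$ and let $\xi(r)=\sup_{0<p_0<1}\xi(r,p_0)$. Then: (a) for every $p_0\in(0,1)$ a positive solution on $[0,\infty)$ exists for which the integral converges and the limits exist, and the number $\xi(r,p_0)$ is uniquely determined;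 the supremum $\xi(r)$ is finite; (b) for $r=3,4,\dots,10$ the constant $\xi(r)$ is at least $0.7268$, $0.6045$, $0.5269$, $0.4711$, $0.4283$, $0.3940$, $0.3658$, $0.3419$, respectively; (c) for every fixed $\varepsilon>0$, the probability that a uniformly random labelled $r$-regular simple graph on $n$ vertices contains an induced forest (an acyclic induced subgraph) with at least $(\xi(r)-\varepsilon)n$ vertices tends to $1$ as $n\to\infty$ over the integers $n$ with $rn$ even. -/

import Mathlib

open Filter Topology MeasureTheory

noncomputable section

namespace InducedForest

/-- `(w, b, q, s, t)` is a positive solution on `[0, ∞)` of the system of differential equations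
associated with `(r, p₀)`. At the endpoint `0` the derivative is one-sided, at every other point
it is the ordinary derivative. -/
structure IsSolution (r : ℕ) (p₀ : ℝ) (w b q s t : ℝ → ℝ) : Prop where
  w_pos : ∀ x, 0 ≤ x → 0 < w x
  b_pos : ∀ x, 0 ≤ x → 0 < b x
  q_pos : ∀ x, 0 ≤ x → 0 < q x
  s_pos : ∀ x, 0 ≤ x → 0 < s x
  t_pos : ∀ x, 0 ≤ x → 0 < t x
  w_zero : w 0 = (1 - p₀) ^ (r + 1)
  b_zero : b 0 = r * p₀ * (1 - p₀) ^ r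
  q_zero : q 0 = (1 - p₀) ^ (2 * r)
  s_zero : s 0 = ((r : ℝ) - 1) * p₀ * (1 - p₀) ^ (2 * r - 1)
  t_zero : t 0 = ((r : ℝ) - 1) ^ 2 * p₀ ^ 2 * (1 - p₀) ^ (2 * r - 2)
  w_deriv : ∀ x, 0 ≤ x → HasDerivWithinAt w (-(r * s x)) (Set.Ici 0) x
  b_deriv : ∀ x, 0 ≤ x → HasDerivWithinAt b (-b x - r * t x + r * s x) (Set.Ici 0) x
  q_deriv : ∀ x, 0 ≤ x →
    HasDerivWithinAt q (-((2 * (r : ℝ) - 2) * q x * s x / w x)) (Set.Ici 0) x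
  s_deriv : ∀ x, 0 ≤ x →
    HasDerivWithinAt s
      (-s x + ((r : ℝ) - 1) * q x * s x / w x - ((r : ℝ) - 1) * s x ^ 2 / w x
        - r * ((r : ℝ) - 2) * s x * t x / (((r : ℝ) - 1) * b x)) (Set.Ici 0) x
  t_deriv : ∀ x, 0 ≤ x →
    HasDerivWithinAt t
      (-2 * t x + 2 * ((r : ℝ) - 1) * s x ^ 2 / w x
        - 2 * r * ((r : ℝ) - 2) * t x ^ 2 / (((r : ℝ) - 1) * b x)) (Set.Ici 0) x

/-- `v` is the constant `ξ(r, p₀)`: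
`p₀ (1 - p₀) ^ r + ∫₀^∞ b + lim w` if `lim (r - 1) q / w < 1`, and
`p₀ (1 - p₀) ^ r + ∫₀^∞ b` otherwise, where `w`, `b`, `q` come from the solution of the system
associated with `(r, p₀)`. The integral has to converge and both limits have to exist. -/
def IsXi (r : ℕ) (p₀ v : ℝ) : Prop :=
  ∃ (w b q s t : ℝ → ℝ) (wLim ρ : ℝ),
    IsSolution r p₀ w b q s t ∧
    IntegrableOn b (Set.Ioi 0) ∧
    Tendsto w atTop (𝓝 wLim) ∧
    Tendsto (fun x => ((r : ℝ) - 1) * q x / w x) atTop (𝓝 ρ) ∧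
    v = p₀ * (1 - p₀) ^ r + (∫ x in Set.Ioi (0 : ℝ), b x) + (if ρ < 1 then wLim else 0)

/-- The set of all constants `ξ(r, p₀)`, `0 < p₀ < 1`. -/
def xiValues (r : ℕ) : Set ℝ := {v | ∃ p₀ ∈ Set.Ioo (0 : ℝ) 1, IsXi r p₀ v}

/-- `ξ(r)`, the best of the constants `ξ(r, p₀)`. -/
def xi (r : ℕ) : ℝ := sSup (xiValues r)

/-- Numerical values of the constants for `3 ≤ r ≤ 10` (not used for other `r`). -/
def xiTable : ℕ → ℝ
  | 3 => 0.7268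
  | 4 => 0.6045
  | 5 => 0.5269
  | 6 => 0.4711
  | 7 => 0.4283
  | 8 => 0.3940
  | 9 => 0.3658
  | 10 => 0.3419
  | _ => 0

open Classical in
/-- The set of all `r`-regular (simple, labelled) graphs on the vertex set `Fin n`. -/
def regularGraphs (r n : ℕ) : Set (SimpleGraph (Fin n)) := {G | G.IsRegularOfDegree r}

/-- The probability that a uniformly random `r`-regular graph on `n` vertices lies in `A`. -/
def regularProb (r n : ℕ) (A : Set (SimpleGraph (Fin n))) : ℝ :=
  ((regularGraphs r n ∩ A).ncard : ℝ) / ((regularGraphs r n).ncard : ℝ)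

/-- A random `r`-regular graph on `n` vertices is asymptotically almost surely in `A n`. The limit
`n → ∞` runs over those `n` for which `r * n` is even, as `r`-regular graphs on `n` vertices exist
for no other `n`. -/
def AAS (r : ℕ) (A : (n : ℕ) → Set (SimpleGraph (Fin n))) : Prop :=
  Tendsto (fun n => regularProb r n (A n)) (atTop ⊓ 𝓟 {n : ℕ | Even (r * n)}) (𝓝 1)

/-- `G` contains an induced forest with at least `m` vertices. -/
def HasInducedForest {n : ℕ} (G : SimpleGraph (Fin n)) (m : ℝ) : Prop :=
  ∃ S : Finset (Fin n), (G.induce (S : Set (Fin n))).IsAcyclic ∧ m ≤ (S.card : ℝ)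

end InducedForest

end

/-!
The system has first integrals: with `a` the probability that a branch of the `r`-regular tree stays
silent, all five functions are explicit in `a`, which decreases from `1 - p₀` to the largest zero of
a concave function. So `ξ(r, p₀)` is an explicit expression in this zero.

This expression is also the expected density of an induced forest. Each vertex becomes a seed with
probability `p₀`, and each vertex with exactly one active neighbour becomes active after a random
geometric delay, so that the active vertices span a forest; the white vertices that remain span a
subcritical forest. On an `r`-regular graph the process at a vertex with tree-like neighbourhood is
governed by a recursion for the silence probability, and as the delays become finer this recursion
follows the equation for `a`. By the switching method, in a random regular graph the expected number
of vertices near a short cycle is bounded.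
-/

noncomputable section

namespace InducedForest

lemma integral_le_sub_mul_of_monotoneOn {f : ℝ → ℝ} {a b : ℝ} (hf : MonotoneOn f (Set.uIcc a b)) :
    ∫ x in a..b, f x ≤ (b - a) * f b := by
  rw [← smul_eq_mul, ← intervalIntegral.integral_const]
  rcases le_total a b with hab | hab
  · exact intervalIntegral.integral_mono_on hab hf.intervalIntegrable (by simp) fun x hx =>
      hf (Set.Icc_subset_uIcc hx) Set.right_mem_uIcc hx.2
  · rw [intervalIntegral.integral_symm b a, intervalIntegral.integral_symm b a, neg_le_neg_iff]
    exact intervalIntegral.integral_mono_on hab (by simp) hf.intervalIntegrable.symm fun x hx =>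
      hf Set.right_mem_uIcc (Set.Icc_subset_uIcc' hx) hx.1

lemma exists_last_zero {f : ℝ → ℝ} {a b : ℝ} (hf : ContinuousOn f (Set.Icc a b)) (hab : a ≤ b)
    (ha : f a ≤ 0) (hb : 0 < f b) : ∃ c ∈ Set.Ico a b, f c = 0 ∧ ∀ x ∈ Set.Ioc c b, 0 < f x := by
  have hcompact : IsCompact (Set.Icc a b ∩ f ⁻¹' Set.Iic 0) :=
    isCompact_Icc.of_isClosed_subset (hf.preimage_isClosed_of_isClosed isClosed_Icc isClosed_Iic)
      Set.inter_subset_left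
  obtain ⟨c, ⟨hc, hfc⟩, hmax⟩ := hcompact.exists_isGreatest ⟨a, ⟨le_rfl, hab⟩, ha⟩
  have hcb : c < b := hc.2.lt_of_ne (by rintro rfl; exact hb.not_ge hfc)
  have hpos : ∀ x ∈ Set.Ioc c b, 0 < f x := fun x hx => by
    by_contra! hfx
    exact hx.1.not_ge (hmax ⟨⟨hc.1.trans hx.1.le, hx.2⟩, hfx⟩)
  obtain ⟨z, hz, hfz⟩ := intermediate_value_Icc hcb.le
    (hf.mono (Set.Icc_subset_Icc_left hc.1)) ⟨hfc, hb.le⟩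
  obtain rfl : c = z := hz.1.eq_of_not_lt fun hlt => (hpos z ⟨hlt, hz.2⟩).ne' hfz
  exact ⟨c, ⟨hc.1, hcb⟩, hfz, hpos⟩

lemma surjective_of_le_deriv {f : ℝ → ℝ} {c : ℝ} (hc : 0 < c) (hf : Differentiable ℝ f)
    (hf' : ∀ x, c ≤ deriv f x) : Function.Surjective f := by
  have hgrowth := mul_sub_le_image_sub_of_le_deriv hf hf'
  refine hf.continuous.surjective ?_ ?_
  · refine tendsto_atTop_mono' _ ?_
      (tendsto_atTop_add_const_left _ (f 0) (tendsto_id.const_mul_atTop hc))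
    filter_upwards [eventually_ge_atTop 0] with x hx
    linarith [hgrowth hx, show c * (x - 0) = c * id x by simp]
  · refine tendsto_atBot_mono' _ ?_
      (tendsto_atBot_add_const_left _ (f 0) (tendsto_id.const_mul_atBot hc))
    filter_upwards [eventually_le_atBot 0] with x hx
    linarith [hgrowth hx, show c * (0 - x) = -(c * id x) by simp]

-- The solution is the inverse of the travel time `z ↦ ∫ 1 / H` from `z₀` to `z`.
lemma exists_global_flow {H : ℝ → ℝ} (hH : Continuous H) (hpos : ∀ z, 0 < H z) {L : ℝ}
    (hL : ∀ z, H z ≤ L) (z₀ : ℝ) :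
    ∃ z : ℝ → ℝ, z 0 = z₀ ∧ Monotone z ∧ Tendsto z atBot atBot ∧
      ∀ x, HasDerivAt z (H (z x)) x := by
  have hLpos : 0 < L := (hpos 0).trans_le (hL 0)
  let T : ℝ → ℝ := fun z => ∫ v in z₀..z, 1 / H v
  have hderiv : ∀ z, HasDerivAt T (1 / H z) z := fun z =>
    ((continuous_const.div hH fun v => (hpos v).ne').integral_hasStrictDerivAt z₀ z).hasDerivAt
  have hmono : StrictMono T := strictMono_of_deriv_pos fun z => by
    rw [(hderiv z).deriv]
    exact one_div_pos.2 (hpos z)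
  have hsurj : Function.Surjective T :=
    surjective_of_le_deriv (one_div_pos.2 hLpos) (fun z => (hderiv z).differentiableAt) fun z => by
      rw [(hderiv z).deriv]
      exact one_div_le_one_div_of_le (hpos z) (hL z)
  let e := hmono.orderIsoOfSurjective T hsurj
  refine ⟨e.symm, ?_, e.symm.monotone, e.symm.tendsto_atBot, fun x => ?_⟩
  · rw [OrderIso.symm_apply_eq]
    exact intervalIntegral.integral_same.symm
  · simpa using HasDerivAt.of_local_left_inverse e.symm.continuous.continuousAt
      (hderiv (e.symm x)) (one_div_pos.2 (hpos _)).ne' (Eventually.of_forall e.apply_symm_apply)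

lemma exists_flow_tendsto_equilibrium {F : ℝ → ℝ} {α β C : ℝ} (hαβ : α < β)
    (hF : ContinuousOn F (Set.Ioc α β)) (hpos : ∀ z ∈ Set.Ioc α β, 0 < F z)
    (hle : ∀ z ∈ Set.Ioc α β, F z ≤ C * (z - α)) :
    ∃ a : ℝ → ℝ, a 0 = β ∧ Tendsto a atTop (𝓝 α) ∧
      ∀ x, 0 ≤ x → a x ∈ Set.Ioc α β ∧ HasDerivAt a (-F (a x)) x := by
  have hβ := Set.right_mem_Ioc.2 hαβ
  have hC : 0 < C :=
    pos_of_mul_pos_left ((hpos β hβ).trans_le (hle β hβ)) (sub_nonneg.2 hαβ.le)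
  -- In the coordinate `z = log (a - α)` the speed is bounded, so that the flow is global.
  let m : ℝ → ℝ := fun z => min (α + Real.exp z) β
  have hm : ∀ z, m z ∈ Set.Ioc α β := fun z =>
    ⟨lt_min (by linarith [Real.exp_pos z]) hαβ, min_le_right _ _⟩
  have hspeed : ∀ z, F (m z) / Real.exp z ≤ C := fun z => by
    rw [div_le_iff₀ (Real.exp_pos z)]
    have hmz : m z - α ≤ Real.exp z := by linarith [min_le_left (α + Real.exp z) β]
    exact (hle _ (hm z)).trans (by gcongr)
  obtain ⟨z, hz0, hmono, hbot, hz⟩ := exists_global_flow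
    ((hF.comp_continuous (by fun_prop) hm).div Real.continuous_exp fun z => (Real.exp_pos z).ne')
    (fun z => div_pos (hpos _ (hm z)) (Real.exp_pos z)) hspeed (Real.log (β - α))
  have hexp0 : Real.exp (z 0) = β - α := by rw [hz0, Real.exp_log (sub_pos.2 hαβ)]
  refine ⟨fun x => α + Real.exp (z (-x)), by simp [hexp0], ?_, fun x hx => ?_⟩
  · simpa using (Real.tendsto_exp_atBot.comp (hbot.comp tendsto_neg_atTop_atBot)).const_add α
  · have hxβ : α + Real.exp (z (-x)) ≤ β := by
      linarith [Real.exp_le_exp.2 (hmono (neg_nonpos.2 hx))]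
    refine ⟨⟨by linarith [Real.exp_pos (z (-x))], hxβ⟩, ?_⟩
    refine ((((hz (-x)).comp x (hasDerivAt_neg x)).exp).const_add α).congr_deriv ?_
    have hmz : m (z (-x)) = α + Real.exp (z (-x)) := min_eq_left hxβ
    simp only [Pi.div_apply, Function.comp_apply, hmz]
    field_simp

lemma eqOn_Ici_of_locallyLipschitzOn {E : Type*} [NormedAddCommGroup E] [NormedSpace ℝ E]
    {v : E → E} {U : Set E} {f g : ℝ → E} {a : ℝ} (hv : LocallyLipschitzOn U v)
    (hf : ∀ x ∈ Set.Ici a, f x ∈ U ∧ HasDerivWithinAt f (v (f x)) (Set.Ici a) x)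
    (hg : ∀ x ∈ Set.Ici a, g x ∈ U ∧ HasDerivWithinAt g (v (g x)) (Set.Ici a) x)
    (hfg : f a = g a) : Set.EqOn f g (Set.Ici a) := by
  intro b hb
  have hcont : ∀ {f : ℝ → E},
      (∀ x ∈ Set.Ici a, f x ∈ U ∧ HasDerivWithinAt f (v (f x)) (Set.Ici a) x) →
      ContinuousOn f (Set.Icc a b) := fun hf x hx =>
    (hf x hx.1).2.continuousWithinAt.mono Set.Icc_subset_Ici_self
  have hcompact : IsCompact (f '' Set.Icc a b ∪ g '' Set.Icc a b) :=
    (isCompact_Icc.image_of_continuousOn (hcont hf)).union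
      (isCompact_Icc.image_of_continuousOn (hcont hg))
  have hU : f '' Set.Icc a b ∪ g '' Set.Icc a b ⊆ U :=
    Set.union_subset (Set.image_subset_iff.2 fun x hx => (hf x hx.1).1)
      (Set.image_subset_iff.2 fun x hx => (hg x hx.1).1)
  obtain ⟨L, hL⟩ :=
    LocallyLipschitzOn.exists_lipschitzOnWith_of_compact hcompact (hv.mono hU)
  exact ODE_solution_unique_of_mem_Icc_right (v := fun _ => v)
    (s := fun _ => f '' Set.Icc a b ∪ g '' Set.Icc a b) (fun _ _ => hL) (hcont hf)
    (fun x hx => (hf x hx.1).2.mono (Set.Ici_subset_Ici.2 hx.1))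
    (fun x hx => Or.inl (Set.mem_image_of_mem f (Set.Ico_subset_Icc_self hx))) (hcont hg)
    (fun x hx => (hg x hx.1).2.mono (Set.Ici_subset_Ici.2 hx.1))
    (fun x hx => Or.inr (Set.mem_image_of_mem g (Set.Ico_subset_Icc_self hx))) hfg
    (Set.right_mem_Icc.2 hb)

/-- The mean number `(r - 1) (1 - p) a ^ (r - 2)` of children of a white vertex whose remaining
branches are silent and which are no seeds, when a branch is silent with probability `a`. -/
def branchRate (r : ℕ) (p a : ℝ) : ℝ := ((r : ℝ) - 1) * (1 - p) * a ^ (r - 2)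

/-- The rescaled density of blue vertices at silence probability `a`: the first integral of the
system with the value `p` at the start `a = 1 - p`. -/
def blueMass (r : ℕ) (p a : ℝ) : ℝ := p + ∫ v in a..(1 - p), (1 - 1 / branchRate r p v)

/-- The density of the forest when the process with seed density `p` stops at silence
probability `a`: seeds without neighbouring seeds, then `∫ b`, then the white vertices. -/
def forestDensity (r : ℕ) (p a : ℝ) : ℝ :=
  p * (1 - p) ^ r + r / (2 * ((r : ℝ) - 1)) * ((1 - p) ^ 2 - a ^ 2) + (1 - p) * a ^ r

/-- `α` is the silence probability at which the process stops: the largest zero of the blue mass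
below `1 - p`. -/
structure IsStop (r : ℕ) (p α : ℝ) : Prop where
  pos : 0 < α
  lt_one_sub : α < 1 - p
  branchRate_lt_one : branchRate r p α < 1
  blueMass_eq_zero : blueMass r p α = 0
  blueMass_pos : ∀ a ∈ Set.Ioc α (1 - p), 0 < blueMass r p a

section

variable {r : ℕ} {p a b : ℝ}

lemma cast_sub_one_pos (hr : 2 ≤ r) : 0 < (r : ℝ) - 1 :=
  sub_pos.2 (by exact_mod_cast hr)

lemma branchRate_pos (hr : 2 ≤ r) (hp : p < 1) (ha : 0 < a) : 0 < branchRate r p a :=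
  mul_pos (mul_pos (cast_sub_one_pos hr) (sub_pos.2 hp)) (pow_pos ha _)

lemma monotoneOn_branchRate (hr : 1 ≤ r) (hp : p ≤ 1) :
    MonotoneOn (branchRate r p) (Set.Ici 0) := fun _ ha _ _ hab =>
  mul_le_mul_of_nonneg_left (pow_le_pow_left₀ ha hab _)
    (mul_nonneg (sub_nonneg.2 (by exact_mod_cast hr)) (sub_nonneg.2 hp))

lemma continuous_branchRate : Continuous (branchRate r p) := by
  unfold branchRate
  fun_prop

lemma continuousOn_one_sub_inv_branchRate (hr : 2 ≤ r) (hp : p < 1) :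
    ContinuousOn (fun v => 1 - 1 / branchRate r p v) (Set.Ioi 0) :=
  continuousOn_const.sub (continuousOn_const.div continuous_branchRate.continuousOn
    fun _ hx => (branchRate_pos hr hp hx).ne')

lemma monotoneOn_one_sub_inv_branchRate (hr : 2 ≤ r) (hp : p < 1) :
    MonotoneOn (fun v => 1 - 1 / branchRate r p v) (Set.Ioi 0) := fun _ hx _ _ hxy =>
  sub_le_sub_left (one_div_le_one_div_of_le (branchRate_pos hr hp hx)
    (monotoneOn_branchRate (by lia) hp.le (Set.mem_Ici_of_Ioi hx) ((le_of_lt hx).trans hxy) hxy)) 1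

lemma intervalIntegrable_one_sub_inv_branchRate (hr : 2 ≤ r) (hp : p < 1) (ha : 0 < a)
    (hb : 0 < b) : IntervalIntegrable (fun v => 1 - 1 / branchRate r p v) volume a b :=
  ((continuousOn_one_sub_inv_branchRate hr hp).mono fun _ hx =>
    (lt_min ha hb).trans_le hx.1).intervalIntegrable

lemma blueMass_one_sub : blueMass r p (1 - p) = p := by simp [blueMass]

lemma hasDerivAt_blueMass (hr : 2 ≤ r) (hp : p < 1) (ha : 0 < a) :
    HasDerivAt (blueMass r p) (-(1 - 1 / branchRate r p a)) a := by
  have hcont := continuousOn_one_sub_inv_branchRate hr hp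
  exact (intervalIntegral.integral_hasDerivAt_left
    (intervalIntegrable_one_sub_inv_branchRate hr hp ha (sub_pos.2 hp))
    (hcont.stronglyMeasurableAtFilter isOpen_Ioi a ha)
    (hcont.continuousAt (Ioi_mem_nhds ha))).const_add p

lemma continuousOn_blueMass (hr : 2 ≤ r) (hp : p < 1) :
    ContinuousOn (blueMass r p) (Set.Ioi 0) := fun _ hx =>
  (hasDerivAt_blueMass hr hp hx).continuousAt.continuousWithinAt

-- The blue mass is concave, hence lies below its tangents.
lemma blueMass_le_tangent (hr : 2 ≤ r) (hp : p < 1) (ha : 0 < a) (hb : 0 < b) :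
    blueMass r p a ≤ blueMass r p b + (b - a) * (1 - 1 / branchRate r p b) := by
  have hsplit : blueMass r p a = blueMass r p b + ∫ v in a..b, (1 - 1 / branchRate r p v) := by
    unfold blueMass
    rw [← intervalIntegral.integral_add_adjacent_intervals
      (intervalIntegrable_one_sub_inv_branchRate hr hp ha hb)
      (intervalIntegrable_one_sub_inv_branchRate hr hp hb (sub_pos.2 hp))]
    ring
  rw [hsplit]
  gcongr
  exact integral_le_sub_mul_of_monotoneOn ((monotoneOn_one_sub_inv_branchRate hr hp).mono
    fun x hx => (lt_min ha hb).trans_le hx.1)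

lemma le_blueMass_of_one_le_branchRate (hr : 2 ≤ r) (hp : p < 1) (ha : 0 < a) (hap : a ≤ 1 - p)
    (hrate : 1 ≤ branchRate r p a) : p ≤ blueMass r p a := by
  have htangent := blueMass_le_tangent hr hp (sub_pos.2 hp) ha
  rw [blueMass_one_sub] at htangent
  have hinv : 1 / branchRate r p a ≤ 1 := div_le_one_of_le₀ hrate (by linarith)
  nlinarith

lemma branchRate_le_mul (hr : 3 ≤ r) (hp : 0 ≤ p) (ha : 0 ≤ a) (ha1 : a ≤ 1) :
    branchRate r p a ≤ ((r : ℝ) - 1) * a := by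
  have hr1 := cast_sub_one_pos (r := r) (by lia)
  calc ((r : ℝ) - 1) * (1 - p) * a ^ (r - 2) ≤ ((r : ℝ) - 1) * 1 * a ^ 1 := by
        gcongr ?_ * ?_ * ?_
        · linarith
        · exact pow_le_pow_of_le_one ha ha1 (by lia)
    _ = ((r : ℝ) - 1) * a := by ring

lemma blueMass_le_log (hr : 3 ≤ r) (hp0 : 0 ≤ p) (hp : p < 1) (ha : 0 < a) (hap : a ≤ 1 - p) :
    blueMass r p a ≤ 1 - 1 / ((r : ℝ) - 1) * Real.log ((1 - p) / a) := by
  have hq : 0 < 1 - p := sub_pos.2 hp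
  have hinv : IntervalIntegrable (fun v : ℝ => 1 / ((r : ℝ) - 1) * v⁻¹) volume a (1 - p) :=
    (intervalIntegrable_inv_iff.2 (Or.inr fun h =>
      (lt_min ha hq).not_ge h.1)).const_mul _
  have hle : ∫ v in a..(1 - p), (1 - 1 / branchRate r p v)
      ≤ ∫ v in a..(1 - p), (1 - 1 / ((r : ℝ) - 1) * v⁻¹) := by
    refine intervalIntegral.integral_mono_on hap
      (intervalIntegrable_one_sub_inv_branchRate (by lia) hp ha hq)
      (intervalIntegrable_const.sub hinv) fun x hx => ?_
    have hx0 : 0 < x := ha.trans_le hx.1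
    rw [one_div, one_div, ← mul_inv]
    exact sub_le_sub_left (inv_anti₀ (branchRate_pos (by lia) hp hx0)
      (branchRate_le_mul hr hp0 hx0.le (by linarith [hx.2]))) 1
  rw [intervalIntegral.integral_sub intervalIntegrable_const hinv,
    intervalIntegral.integral_const_mul, integral_inv_of_pos ha hq,
    intervalIntegral.integral_const, smul_eq_mul, mul_one] at hle
  unfold blueMass
  linarith

lemma exists_blueMass_nonpos (hr : 3 ≤ r) (hp0 : 0 ≤ p) (hp : p < 1) :
    ∃ a, 0 < a ∧ a ≤ 1 - p ∧ blueMass r p a ≤ 0 := by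
  have hq : 0 < 1 - p := sub_pos.2 hp
  have hr1 := cast_sub_one_pos (r := r) (by lia)
  have ha : 0 < (1 - p) * Real.exp (-r) := by positivity
  have hap : (1 - p) * Real.exp (-r) ≤ 1 - p :=
    mul_le_of_le_one_right hq.le (Real.exp_le_one_iff.2 (by simp))
  refine ⟨_, ha, hap, (blueMass_le_log hr hp0 hp ha hap).trans ?_⟩
  have hlog : Real.log ((1 - p) / ((1 - p) * Real.exp (-r))) = r := by
    rw [div_mul_cancel_left₀ hq.ne', Real.exp_neg, inv_inv, Real.log_exp]
  rw [hlog, sub_nonpos, one_div_mul_eq_div, one_le_div hr1]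
  linarith

lemma exists_isStop (hr : 3 ≤ r) (hp0 : 0 < p) (hp : p < 1) : ∃ α, IsStop r p α := by
  obtain ⟨e, he, hep, hmass⟩ := exists_blueMass_nonpos hr hp0.le hp
  obtain ⟨α, ⟨heα, hα⟩, hzero, hpos⟩ := exists_last_zero
    ((continuousOn_blueMass (by lia) hp).mono fun x hx => he.trans_le hx.1) hep hmass
    (blueMass_one_sub.symm ▸ hp0)
  have hα0 : 0 < α := he.trans_le heα
  refine ⟨α, hα0, hα, ?_, hzero, hpos⟩
  by_contra! hrate
  linarith [le_blueMass_of_one_le_branchRate (by lia) hp hα0 hα.le hrate]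

lemma hasDerivAt_forestDensity (hr : 2 ≤ r) (x : ℝ) :
    HasDerivAt (forestDensity r p) (-(r / ((r : ℝ) - 1) * x * (1 - branchRate r p x))) x := by
  have hderiv := ((((hasDerivAt_id x).pow 2).const_sub ((1 - p) ^ 2)).const_mul
    (r / (2 * ((r : ℝ) - 1)))).const_add (p * (1 - p) ^ r) |>.add
      (((hasDerivAt_id x).pow r).const_mul (1 - p))
  refine hderiv.congr_deriv ?_
  obtain ⟨k, rfl⟩ := Nat.exists_eq_add_of_le' hr
  have hr1 := (cast_sub_one_pos hr).ne'
  simp only [branchRate, id, Nat.add_sub_cancel, show k + 2 - 1 = k + 1 by lia]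
  field_simp
  ring

lemma antitoneOn_forestDensity (hr : 2 ≤ r) (hp : p ≤ 1) (hb : branchRate r p b ≤ 1) :
    AntitoneOn (forestDensity r p) (Set.Icc 0 b) := by
  refine antitoneOn_of_hasDerivWithinAt_nonpos (convex_Icc 0 b)
    (fun x _ => (hasDerivAt_forestDensity hr x).continuousAt.continuousWithinAt)
    (fun x _ => (hasDerivAt_forestDensity hr x).hasDerivWithinAt) fun x hx => ?_
  rw [interior_Icc] at hx
  have hrate : branchRate r p x ≤ 1 :=
    (monotoneOn_branchRate (by lia) hp hx.1.le (hx.1.trans hx.2).le hx.2.le).trans hb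
  exact neg_nonpos.2 (mul_nonneg (mul_nonneg
    (div_nonneg (Nat.cast_nonneg r) (cast_sub_one_pos hr).le) hx.1.le) (sub_nonneg.2 hrate))

namespace IsStop

variable {α : ℝ}

lemma le_of_blueMass_nonneg (h : IsStop r p α) (hr : 2 ≤ r) (hp : p < 1) (hb : 0 < b)
    (hmass : 0 ≤ blueMass r p b) : α ≤ b := by
  by_contra! hlt
  have htangent := blueMass_le_tangent hr hp hb h.pos
  rw [h.blueMass_eq_zero] at htangent
  have hinv : 1 < 1 / branchRate r p α :=
    (one_lt_div (branchRate_pos hr hp h.pos)).2 h.branchRate_lt_one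
  nlinarith

lemma blueMass_le (h : IsStop r p α) (hr : 2 ≤ r) (hp : p < 1) (ha : α ≤ a) :
    blueMass r p a ≤ (a - α) / branchRate r p α := by
  have htangent := blueMass_le_tangent hr hp (h.pos.trans_le ha) h.pos
  rw [h.blueMass_eq_zero] at htangent
  calc blueMass r p a ≤ (a - α) * (1 / branchRate r p α) - (a - α) := by linarith
    _ ≤ (a - α) * (1 / branchRate r p α) := sub_le_self _ (sub_nonneg.2 ha)
    _ = (a - α) / branchRate r p α := mul_one_div _ _

lemma exists_silence_curve (h : IsStop r p α) (hr : 2 ≤ r) (hp : p < 1) :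
    ∃ a : ℝ → ℝ, a 0 = 1 - p ∧ Tendsto a atTop (𝓝 α) ∧ ∀ x, 0 ≤ x → a x ∈ Set.Ioc α (1 - p) ∧
      HasDerivAt a (-(branchRate r p (a x) * blueMass r p (a x))) x := by
  refine exists_flow_tendsto_equilibrium (F := fun a => branchRate r p a * blueMass r p a)
    (C := branchRate r p (1 - p) / branchRate r p α) h.lt_one_sub
    (continuous_branchRate.continuousOn.mul
      ((continuousOn_blueMass hr hp).mono fun x hx => h.pos.trans hx.1))
    (fun z hz => mul_pos (branchRate_pos hr hp (h.pos.trans hz.1)) (h.blueMass_pos z hz))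
    fun z hz => ?_
  have hz0 : 0 < z := h.pos.trans hz.1
  calc branchRate r p z * blueMass r p z
      ≤ branchRate r p (1 - p) * ((z - α) / branchRate r p α) :=
        mul_le_mul (monotoneOn_branchRate (by lia) hp.le hz0.le (hz0.trans_le hz.2).le hz.2)
          (h.blueMass_le hr hp hz.1.le) (h.blueMass_pos z hz).le
          (branchRate_pos hr hp (sub_pos.2 hp)).le
    _ = branchRate r p (1 - p) / branchRate r p α * (z - α) := by ring

end IsStop

end

section

variable {r : ℕ} {p a α : ℝ}

lemma hasDerivAt_branchRate (hr : 2 ≤ r) (ha : a ≠ 0) :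
    HasDerivAt (branchRate r p) (((r : ℝ) - 2) * branchRate r p a / a) a := by
  refine ((hasDerivAt_pow (r - 2) a).const_mul (((r : ℝ) - 1) * (1 - p))).congr_deriv ?_
  obtain ⟨k, rfl⟩ := Nat.exists_eq_add_of_le' hr
  rcases k with _ | k
  · simp
  · simp only [branchRate, show k + 1 + 2 - 2 = k + 1 by lia, Nat.add_sub_cancel]
    push_cast
    field_simp
    ring

-- The identities `s² = q t` and `(r - 1)² b² q = r² w² t` hold at time `0` and are preserved. What
-- remains are the silence probability `a`, its rate of decay `c` and the branching rate `K`.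
lemma isSolution_of_reduced {a c K : ℝ → ℝ} (hr : 2 ≤ r)
    (ha0 : a 0 = 1 - p) (hc0 : c 0 = ((r : ℝ) - 1) * p * (1 - p) ^ (r - 1))
    (hK0 : K 0 = ((r : ℝ) - 1) * (1 - p) ^ (r - 1))
    (hpos : ∀ x, 0 ≤ x → 0 < a x ∧ 0 < c x ∧ 0 < K x)
    (ha : ∀ x, 0 ≤ x → HasDerivAt a (-c x) x)
    (hc : ∀ x, 0 ≤ x → HasDerivAt c (c x * (K x - 1 - ((r : ℝ) - 2) * c x / a x)) x)
    (hK : ∀ x, 0 ≤ x → HasDerivAt K (-(((r : ℝ) - 2) * K x * c x / a x)) x) :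
    IsSolution r p (fun x => a x ^ 2 * K x / ((r : ℝ) - 1))
      (fun x => r / ((r : ℝ) - 1) * (a x * c x)) (fun x => (a x * K x / ((r : ℝ) - 1)) ^ 2)
      (fun x => a x * K x * c x / ((r : ℝ) - 1)) (fun x => c x ^ 2) := by
  have hr1 := cast_sub_one_pos hr
  have : 0 < (r : ℝ) := by linarith
  have hpow : (1 - p) ^ r = (1 - p) * (1 - p) ^ (r - 1) :=
    (mul_pow_sub_one (by lia) _).symm
  constructor
  case w_zero => rw [ha0, hK0, show r + 1 = 2 + (r - 1) by lia, pow_add]; field_simp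
  case b_zero => rw [ha0, hc0, hpow]; field_simp
  case q_zero => rw [ha0, hK0, pow_mul', hpow]; field_simp
  case s_zero =>
    rw [ha0, hK0, hc0, show 2 * r - 1 = 1 + (r - 1) * 2 by lia, pow_add, pow_mul]; field_simp
  case t_zero => rw [hc0, show 2 * r - 2 = (r - 1) * 2 by lia, pow_mul]; ring
  all_goals
    intro x hx
    obtain ⟨hax, hcx, hKx⟩ := hpos x hx
  case w_pos | b_pos | q_pos | s_pos | t_pos => positivity
  case w_deriv =>
    refine (((((ha x hx).fun_pow 2).fun_mul (hK x hx)).div_const _).congr_deriv ?_).hasDerivWithinAt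
    field_simp
    ring
  case b_deriv =>
    refine ((((ha x hx).fun_mul (hc x hx)).const_mul _).congr_deriv ?_).hasDerivWithinAt
    field_simp
    ring
  case q_deriv =>
    refine (((((ha x hx).fun_mul (hK x hx)).div_const _).fun_pow 2).congr_deriv ?_).hasDerivWithinAt
    rw [show 2 * (r : ℝ) - 2 = 2 * ((r : ℝ) - 1) by ring, pow_one]
    push_cast
    field_simp
    ring
  case s_deriv =>
    refine (((((ha x hx).fun_mul (hK x hx)).fun_mul (hc x hx)).div_const _).congr_deriv
      ?_).hasDerivWithinAt
    field_simp
    ring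
  case t_deriv =>
    refine (((hc x hx).fun_pow 2).congr_deriv ?_).hasDerivWithinAt
    field_simp
    ring

lemma branchRate_one_sub (hr : 2 ≤ r) :
    branchRate r p (1 - p) = ((r : ℝ) - 1) * (1 - p) ^ (r - 1) := by
  rw [branchRate, mul_assoc, ← pow_succ', show r - 2 + 1 = r - 1 by lia]

lemma hasDerivAt_branchRate_mul_blueMass (hr : 2 ≤ r) (hp : p < 1) (ha : 0 < a) :
    HasDerivAt (fun a => branchRate r p a * blueMass r p a)
      (((r : ℝ) - 2) * branchRate r p a / a * blueMass r p a - (branchRate r p a - 1)) a := by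
  have hK := (branchRate_pos hr hp ha).ne'
  refine ((hasDerivAt_branchRate hr ha.ne').mul (hasDerivAt_blueMass hr hp ha)).congr_deriv ?_
  field_simp
  ring

lemma integral_mul_neg_deriv {f g : ℝ → ℝ} {l : ℝ} (hlim : Tendsto f atTop (𝓝 l))
    (hf : ∀ x, 0 ≤ x → HasDerivAt f (-g x) x) (hfg : ∀ x, 0 ≤ x → 0 ≤ f x * g x) :
    IntegrableOn (fun x => f x * g x) (Set.Ioi 0) ∧
      ∫ x in Set.Ioi 0, f x * g x = (f 0 ^ 2 - l ^ 2) / 2 := by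
  have hderiv : ∀ x ∈ Set.Ici (0 : ℝ), HasDerivAt (fun x => -(f x ^ 2 / 2)) (f x * g x) x :=
    fun x hx => (((hf x hx).fun_pow 2).div_const 2).neg.congr_deriv (by push_cast; ring)
  have hnonneg : ∀ x ∈ Set.Ioi (0 : ℝ), 0 ≤ f x * g x := fun x hx => hfg x (le_of_lt hx)
  have hlim' := ((hlim.pow 2).div_const 2).neg
  refine ⟨integrableOn_Ioi_deriv_of_nonneg' hderiv hnonneg hlim', ?_⟩
  rw [integral_Ioi_of_hasDerivAt_of_nonneg' hderiv hnonneg hlim']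
  ring

namespace IsStop

lemma isXi (h : IsStop r p α) (hr : 2 ≤ r) (hp : p < 1) : IsXi r p (forestDensity r p α) := by
  obtain ⟨a, ha0, hlim, ha⟩ := h.exists_silence_curve hr hp
  have hr1 := cast_sub_one_pos hr
  set K : ℝ → ℝ := fun x => branchRate r p (a x)
  set c : ℝ → ℝ := fun x => K x * blueMass r p (a x)
  have hapos : ∀ x, 0 ≤ x → 0 < a x := fun x hx => h.pos.trans (ha x hx).1.1
  have hKpos : ∀ x, 0 ≤ x → 0 < K x := fun x hx => branchRate_pos hr hp (hapos x hx)
  have hcpos : ∀ x, 0 ≤ x → 0 < c x := fun x hx =>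
    mul_pos (hKpos x hx) (h.blueMass_pos _ (ha x hx).1)
  have hK : ∀ x, 0 ≤ x → HasDerivAt K (-(((r : ℝ) - 2) * K x * c x / a x)) x := fun x hx =>
    ((hasDerivAt_branchRate hr (hapos x hx).ne').comp x (ha x hx).2).congr_deriv (by ring)
  have hc : ∀ x, 0 ≤ x → HasDerivAt c (c x * (K x - 1 - ((r : ℝ) - 2) * c x / a x)) x := by
    intro x hx
    refine ((hasDerivAt_branchRate_mul_blueMass hr hp (hapos x hx)).comp x
      (ha x hx).2).congr_deriv ?_
    simp only [c, K]
    ring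
  have hK0 : K 0 = ((r : ℝ) - 1) * (1 - p) ^ (r - 1) := by
    simp only [K, ha0, branchRate_one_sub hr]
  have hc0 : c 0 = ((r : ℝ) - 1) * p * (1 - p) ^ (r - 1) := by
    simp only [c, hK0, ha0, blueMass_one_sub]
    ring
  obtain ⟨hint, hval⟩ := integral_mul_neg_deriv hlim (fun x hx => (ha x hx).2)
    (fun x hx => mul_nonneg (hapos x hx).le (hcpos x hx).le)
  have hKlim : Tendsto K atTop (𝓝 (branchRate r p α)) :=
    (continuous_branchRate.tendsto α).comp hlim
  refine ⟨_, _, _, _, _, _, branchRate r p α,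
    isSolution_of_reduced hr ha0 hc0 hK0 (fun x hx => ⟨hapos x hx, hcpos x hx, hKpos x hx⟩)
      (fun x hx => (ha x hx).2) hc hK,
    hint.const_mul _,
    ((hlim.pow 2).mul hKlim).div_const _, hKlim.congr' ?_, ?_⟩
  · filter_upwards [eventually_ge_atTop 0] with x hx
    have hax := (hapos x hx).ne'
    have hKx := (hKpos x hx).ne'
    field_simp
  · rw [if_pos h.branchRate_lt_one, integral_const_mul, hval, ha0]
    obtain ⟨k, rfl⟩ := Nat.exists_eq_add_of_le' hr
    simp only [forestDensity, branchRate, Nat.add_sub_cancel]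
    field_simp
    ring

end IsStop

end

/-- The right-hand side of the system, as a vector field in the variables `(w, b, q, s, t)`. -/
def vectorField (r : ℕ) : ℝ × ℝ × ℝ × ℝ × ℝ → ℝ × ℝ × ℝ × ℝ × ℝ := fun (w, b, q, s, t) =>
  (-(r * s),
   -b - r * t + r * s,
   -((2 * (r : ℝ) - 2) * q * s / w),
   -s + ((r : ℝ) - 1) * q * s / w - ((r : ℝ) - 1) * s ^ 2 / w
     - r * ((r : ℝ) - 2) * s * t / (((r : ℝ) - 1) * b),
   -2 * t + 2 * ((r : ℝ) - 1) * s ^ 2 / w - 2 * r * ((r : ℝ) - 2) * t ^ 2 / (((r : ℝ) - 1) * b))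

/-- The part `w > 0`, `b > 0` of phase space, in which the vector field is smooth. -/
def phaseSpace : Set (ℝ × ℝ × ℝ × ℝ × ℝ) := Set.Ioi 0 ×ˢ Set.Ioi 0 ×ˢ Set.univ

lemma locallyLipschitzOn_vectorField {r : ℕ} (hr : 2 ≤ r) :
    LocallyLipschitzOn phaseSpace (vectorField r) := by
  have hconv : Convex ℝ phaseSpace := (convex_Ioi 0).prod ((convex_Ioi 0).prod convex_univ)
  refine ContDiffOn.locallyLipschitzOn hconv ?_
  have hw : ∀ z ∈ phaseSpace, z.1 ≠ 0 := fun z hz => (Set.mem_Ioi.1 hz.1).ne'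
  have hb : ∀ z ∈ phaseSpace, ((r : ℝ) - 1) * z.2.1 ≠ 0 := fun z hz =>
    mul_ne_zero (cast_sub_one_pos hr).ne' (Set.mem_Ioi.1 hz.2.1).ne'
  unfold vectorField
  fun_prop (disch := assumption)

section

variable {r : ℕ} {p v v' x : ℝ} {w b q s t w' b' q' s' t' : ℝ → ℝ}

namespace IsSolution

lemma hasDerivWithinAt (h : IsSolution r p w b q s t) (hx : 0 ≤ x) :
    HasDerivWithinAt (fun y => (w y, b y, q y, s y, t y))
      (vectorField r (w x, b x, q x, s x, t x)) (Set.Ici 0) x :=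
  (h.w_deriv x hx).prodMk ((h.b_deriv x hx).prodMk ((h.q_deriv x hx).prodMk
    ((h.s_deriv x hx).prodMk (h.t_deriv x hx))))

lemma mem_phaseSpace (h : IsSolution r p w b q s t) (hx : 0 ≤ x) :
    (w x, b x, q x, s x, t x) ∈ phaseSpace :=
  ⟨h.w_pos x hx, h.b_pos x hx, trivial⟩

lemma eqOn_Ici (h : IsSolution r p w b q s t) (h' : IsSolution r p w' b' q' s' t') (hr : 2 ≤ r) :
    Set.EqOn (fun y => (w y, b y, q y, s y, t y)) (fun y => (w' y, b' y, q' y, s' y, t' y))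
      (Set.Ici 0) := by
  refine eqOn_Ici_of_locallyLipschitzOn (locallyLipschitzOn_vectorField hr)
    (fun x hx => ⟨h.mem_phaseSpace hx, h.hasDerivWithinAt hx⟩)
    (fun x hx => ⟨h'.mem_phaseSpace hx, h'.hasDerivWithinAt hx⟩) ?_
  simp only [h.w_zero, h'.w_zero, h.b_zero, h'.b_zero, h.q_zero, h'.q_zero, h.s_zero, h'.s_zero,
    h.t_zero, h'.t_zero]

end IsSolution

lemma IsXi.unique (h : IsXi r p v) (h' : IsXi r p v') (hr : 2 ≤ r) : v = v' := by
  obtain ⟨w, b, q, s, t, l, ρ, hs, -, hw, hρ, rfl⟩ := h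
  obtain ⟨w', b', q', s', t', l', ρ', hs', -, hw', hρ', rfl⟩ := h'
  have heq : ∀ x, 0 ≤ x → w x = w' x ∧ b x = b' x ∧ q x = q' x := fun x hx => by
    have hx := hs.eqOn_Ici hs' hr hx
    simp only [Prod.mk.injEq] at hx
    exact ⟨hx.1, hx.2.1, hx.2.2.1⟩
  have hl : l = l' := by
    refine tendsto_nhds_unique (hw.congr' ?_) hw'
    filter_upwards [eventually_ge_atTop 0] with x hx
    exact (heq x hx).1
  have hρρ' : ρ = ρ' := by
    refine tendsto_nhds_unique (hρ.congr' ?_) hρ'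
    filter_upwards [eventually_ge_atTop 0] with x hx
    rw [(heq x hx).1, (heq x hx).2.2]
  have hb : ∫ x in Set.Ioi (0 : ℝ), b x = ∫ x in Set.Ioi (0 : ℝ), b' x :=
    setIntegral_congr_fun measurableSet_Ioi fun x hx => (heq x (le_of_lt hx)).2.1
  rw [hl, hρρ', hb]

end

section

variable {r : ℕ} {p v α β : ℝ}

lemma mem_xiValues_iff (hr : 3 ≤ r) :
    v ∈ xiValues r ↔ ∃ p α, 0 < p ∧ p < 1 ∧ IsStop r p α ∧ v = forestDensity r p α := by
  constructor
  · rintro ⟨p, ⟨hp0, hp⟩, h⟩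
    obtain ⟨α, hα⟩ := exists_isStop hr hp0 hp
    exact ⟨p, α, hp0, hp, hα, h.unique (hα.isXi (by lia) hp) (by lia)⟩
  · rintro ⟨p, α, hp0, hp, hα, rfl⟩
    exact ⟨p, ⟨hp0, hp⟩, hα.isXi (by lia) hp⟩

lemma existsUnique_isXi (hr : 3 ≤ r) (hp0 : 0 < p) (hp : p < 1) : ∃! v, IsXi r p v := by
  obtain ⟨α, hα⟩ := exists_isStop hr hp0 hp
  have hξ := hα.isXi (by lia) hp
  exact ⟨_, hξ, fun v hv => hv.unique hξ (by lia)⟩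

lemma forestDensity_le_three (hr : 2 ≤ r) (hp0 : 0 ≤ p) (hp : p ≤ 1) (hα0 : 0 ≤ α) (hα : α ≤ 1) :
    forestDensity r p α ≤ 3 := by
  have hq0 : 0 ≤ 1 - p := sub_nonneg.2 hp
  have hq : 1 - p ≤ 1 := sub_le_self 1 hp0
  have hr1 := cast_sub_one_pos hr
  have hr2 : (2 : ℝ) ≤ r := by exact_mod_cast hr
  have hseeds : p * (1 - p) ^ r ≤ 1 := mul_le_one₀ hp (pow_nonneg hq0 r) (pow_le_one₀ hq0 hq)
  have hwhite : (1 - p) * α ^ r ≤ 1 := mul_le_one₀ hq (pow_nonneg hα0 r) (pow_le_one₀ hα0 hα)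
  have hblue : r / (2 * ((r : ℝ) - 1)) * ((1 - p) ^ 2 - α ^ 2) ≤ 1 :=
    calc r / (2 * ((r : ℝ) - 1)) * ((1 - p) ^ 2 - α ^ 2)
        ≤ r / (2 * ((r : ℝ) - 1)) * 1 := by
          gcongr
          linarith [sq_nonneg α, pow_le_one₀ (n := 2) hq0 hq]
      _ ≤ 1 := by rw [mul_one, div_le_one (by linarith)]; linarith
  unfold forestDensity
  linarith

lemma isLUB_xi (hr : 3 ≤ r) : IsLUB (xiValues r) (xi r) := by
  refine isLUB_csSup ?_ ⟨3, ?_⟩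
  · obtain ⟨α, hα⟩ := exists_isStop (r := r) (p := 1 / 2) hr (by norm_num) (by norm_num)
    exact ⟨_, 1 / 2, by norm_num, hα.isXi (by lia) (by norm_num)⟩
  · intro v hv
    obtain ⟨p, α, hp0, hp, hα, rfl⟩ := (mem_xiValues_iff hr).1 hv
    exact forestDensity_le_three (by lia) hp0.le hp.le hα.pos.le (by linarith [hα.lt_one_sub])

-- A point `β` at which the blue mass is not used up has not been passed by the process.
lemma forestDensity_le_xi (hr : 3 ≤ r) (hp0 : 0 < p) (hp : p < 1) (hβ : 0 < β)
    (hmass : 0 ≤ blueMass r p β) (hrate : branchRate r p β ≤ 1) : forestDensity r p β ≤ xi r := by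
  obtain ⟨α, hα⟩ := exists_isStop hr hp0 hp
  have hαβ : α ≤ β := hα.le_of_blueMass_nonneg (by lia) hp hβ hmass
  exact (antitoneOn_forestDensity (by lia) hp.le hrate ⟨hα.pos.le, hαβ⟩ ⟨hβ.le, le_rfl⟩ hαβ).trans
    ((isLUB_xi hr).1 ((mem_xiValues_iff hr).2 ⟨p, α, hp0, hp, hα, rfl⟩))

lemma blueMass_eq_of_primitive {F : ℝ → ℝ} (hr : 2 ≤ r) (hp : p < 1) (hα : 0 < α)
    (hF : ∀ x, 0 < x → HasDerivAt F (1 - 1 / branchRate r p x) x) :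
    blueMass r p α = p + (F (1 - p) - F α) := by
  unfold blueMass
  rw [intervalIntegral.integral_eq_sub_of_hasDerivAt
    (fun x hx => hF x ((lt_min hα (sub_pos.2 hp)).trans_le hx.1))
    (intervalIntegrable_one_sub_inv_branchRate hr hp hα (sub_pos.2 hp))]

lemma blueMass_add_four (k : ℕ) (hp : p < 1) (hα : 0 < α) :
    blueMass (k + 4) p α = 1 - α -
      (1 / α ^ (k + 1) - 1 / (1 - p) ^ (k + 1)) / ((k + 1) * (k + 3) * (1 - p)) := by
  rw [blueMass_eq_of_primitive (by lia) hp hα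
    (F := fun x => x + 1 / x ^ (k + 1) / ((k + 1) * (k + 3) * (1 - p))) fun x hx => ?_]
  · ring
  have hq : 1 - p ≠ 0 := (sub_pos.2 hp).ne'
  refine ((hasDerivAt_id x).fun_add ((((hasDerivAt_const x (1 : ℝ)).fun_div
    (hasDerivAt_pow (k + 1) x) (pow_pos hx _).ne')).div_const _)).congr_deriv ?_
  simp only [branchRate, show k + 4 - 2 = k + 2 by lia, Nat.add_sub_cancel]
  push_cast
  rw [show (k : ℝ) + 4 - 1 = k + 3 by ring]
  field_simp
  ring

lemma blueMass_three (hp : p < 1) (hα : 0 < α) :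
    blueMass 3 p α = 1 - α - Real.log ((1 - p) / α) / (2 * (1 - p)) := by
  have hq : 1 - p ≠ 0 := (sub_pos.2 hp).ne'
  rw [blueMass_eq_of_primitive (by lia) hp hα (F := fun x => x - Real.log x / (2 * (1 - p)))
    fun x hx => ?_, Real.log_div hq hα.ne']
  · ring
  refine ((hasDerivAt_id x).fun_sub ((Real.hasDerivAt_log hx.ne').div_const _)).congr_deriv ?_
  norm_num [branchRate]
  field_simp

lemma forestDensity_add_four_le_xi (k : ℕ) (hp0 : 0 < p) (hp : p < 1) (hβ : 0 < β)
    (hmass : 1 / β ^ (k + 1) - 1 / (1 - p) ^ (k + 1) ≤ (1 - β) * ((k + 1) * (k + 3) * (1 - p)))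
    (hrate : ((k : ℝ) + 3) * (1 - p) * β ^ (k + 2) ≤ 1) :
    forestDensity (k + 4) p β ≤ xi (k + 4) := by
  have : 0 < 1 - p := sub_pos.2 hp
  refine forestDensity_le_xi (by lia) hp0 hp hβ ?_ ?_
  · rwa [blueMass_add_four k hp hβ, sub_nonneg, div_le_iff₀ (by positivity)]
  · rw [branchRate, show k + 4 - 2 = k + 2 by lia]
    push_cast
    rwa [show (k : ℝ) + 4 - 1 = k + 3 by ring]

lemma xiTable_three_le : xiTable 3 ≤ xi 3 := by
  have hmass : 0 ≤ blueMass 3 (1 / 10000) (204 / 1000) := by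
    rw [blueMass_three (by norm_num) (by norm_num), sub_nonneg, div_le_iff₀ (by norm_num),
      Real.log_le_iff_le_exp (by norm_num)]
    refine le_trans ?_ (Real.sum_le_exp_of_nonneg (by norm_num) 11)
    norm_num [Finset.sum_range_succ, Nat.factorial]
  calc xiTable 3 ≤ forestDensity 3 (1 / 10000) (204 / 1000) := by
        norm_num [xiTable, forestDensity]
    _ ≤ xi 3 := forestDensity_le_xi le_rfl (by norm_num) (by norm_num) (by norm_num) hmass
        (by norm_num [branchRate])

-- The supremum is approached as `p → 0`. For `p = 1 / 10000` the process stops just below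
-- `β k / 10000` when `r = k + 4`.
lemma xiTable_add_four_le (k : Fin 7) : xiTable (k + 4) ≤ xi (k + 4) := by
  let β : Fin 7 → ℝ := ![3336, 4218, 4863, 5359, 5755, 6080, 6353]
  refine le_trans ?_ (forestDensity_add_four_le_xi (p := 1 / 10000) (β := β k / 10000) k
    (by norm_num) (by norm_num) ?_ ?_ ?_) <;> fin_cases k <;>
    norm_num [β, xiTable, forestDensity]

lemma xiTable_le_xi (hr : 3 ≤ r) (hr' : r ≤ 10) : xiTable r ≤ xi r := by
  obtain rfl | hr4 := hr.eq_or_lt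
  · exact xiTable_three_le
  · simpa only [Nat.sub_add_cancel hr4] using xiTable_add_four_le ⟨r - 4, by lia⟩

end

/-- The discrete process with time step `η`: the pair of the silence probability and of the blue
mass after `i` rounds. -/
def roundState (r : ℕ) (p η : ℝ) : ℕ → ℝ × ℝ
  | 0 => (1 - p, p)
  | i + 1 =>
    let (a, y) := roundState r p η i
    (a - η * branchRate r p a * y, (1 - η) * y + η * branchRate r p a * y)

/-- The probability that a branch is silent up to round `i`. -/
def silence (r : ℕ) (p η : ℝ) (i : ℕ) : ℝ := (roundState r p η i).1

/-- The blue mass before round `i + 1`. -/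
def pressure (r : ℕ) (p η : ℝ) (i : ℕ) : ℝ := (roundState r p η i).2

/-- The probability that a branch fires in round `i`. -/
def fireProb (r : ℕ) (p η : ℝ) : ℕ → ℝ
  | 0 => p
  | i + 1 => η * branchRate r p (silence r p η i) * pressure r p η i

/-- The law of a vertex label: `0` marks a seed, and otherwise the label is the delay, which is
geometric. -/
def labelProb (p η : ℝ) : ℕ → ℝ
  | 0 => p
  | k + 1 => (1 - p) * η * (1 - η) ^ k

/-- The density of the vertices which become purple in round `i + 1`. -/
def purpleDensity (r : ℕ) (p η : ℝ) (i : ℕ) : ℝ :=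
  r * ((1 - p) * η * pressure r p η i) * silence r p η (i + 1) ^ (r - 1)

/-- The density of the forest grown by the discrete process in `N` rounds: the seeds without
neighbouring seeds, the other purple vertices, and the white vertices. Compare `forestDensity`. -/
def processDensity (r : ℕ) (p η : ℝ) (N : ℕ) : ℝ :=
  p * (1 - p) ^ r + ∑ i ∈ Finset.range N, purpleDensity r p η i + (1 - p) * silence r p η N ^ r

section

variable {r : ℕ} {p η : ℝ}

lemma silence_zero : silence r p η 0 = 1 - p := rfl

lemma pressure_zero : pressure r p η 0 = p := rfl

lemma silence_succ (i : ℕ) :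
    silence r p η (i + 1) = silence r p η i - fireProb r p η (i + 1) := rfl

lemma pressure_succ (i : ℕ) :
    pressure r p η (i + 1) = (1 - η) * pressure r p η i + fireProb r p η (i + 1) := rfl

lemma silence_eq_one_sub_sum (i : ℕ) :
    silence r p η i = 1 - ∑ j ∈ Finset.range (i + 1), fireProb r p η j := by
  induction i with
  | zero => simp [silence_zero, fireProb]
  | succ i ih => rw [silence_succ, ih, Finset.sum_range_succ _ (i + 1)]; ring

lemma pressure_eq_sum (i : ℕ) : (1 - p) * η * pressure r p η i =
    ∑ j ∈ Finset.range (i + 1), labelProb p η (i + 1 - j) * fireProb r p η j := by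
  induction i with
  | zero => simp [labelProb, fireProb, pressure_zero]
  | succ i ih =>
    have hdelay : ∀ j ∈ Finset.range (i + 1),
        labelProb p η (i + 1 + 1 - j) = (1 - η) * labelProb p η (i + 1 - j) := fun j hj => by
      obtain ⟨d, rfl⟩ := Nat.exists_eq_add_of_le (Finset.mem_range_succ_iff.1 hj)
      simp only [labelProb, show j + d + 1 + 1 - j = d + 1 + 1 by lia,
        show j + d + 1 - j = d + 1 by lia, pow_succ]
      ring
    rw [pressure_succ, Finset.sum_range_succ, Finset.sum_congr rfl fun j hj => by
        rw [hdelay j hj, mul_assoc],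
      ← Finset.mul_sum, ← ih, Nat.add_sub_cancel_left, labelProb]
    ring

lemma fireProb_succ (i : ℕ) : fireProb r p η (i + 1) =
    ((r : ℝ) - 1) * (∑ j ∈ Finset.range (i + 1), labelProb p η (i + 1 - j) * fireProb r p η j)
      * silence r p η i ^ (r - 2) := by
  rw [← pressure_eq_sum]
  simp only [fireProb, branchRate]
  ring

lemma silence_add_pressure_succ (i : ℕ) : silence r p η (i + 1) + pressure r p η (i + 1) =
    silence r p η i + pressure r p η i - η * pressure r p η i := by
  rw [silence_succ, pressure_succ]
  ring

/-- The parameters of the discrete process are admissible: seeds have density `p`, and the time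
step `η` is so small that every round leaves some branches silent. -/
structure IsTimeStep (r : ℕ) (p η : ℝ) : Prop where
  three_le : 3 ≤ r
  p_pos : 0 < p
  p_lt_one : p < 1
  pos : 0 < η
  mul_lt_one : η * ((r : ℝ) - 1) < 1

/-- The triangle in which the states `(a, y)` of the discrete process stay. -/
structure IsRoundState (p : ℝ) (z : ℝ × ℝ) : Prop where
  fst_pos : 0 < z.1
  fst_le : z.1 ≤ 1 - p
  snd_pos : 0 < z.2
  add_le_one : z.1 + z.2 ≤ 1

namespace IsRoundState

variable {z : ℝ × ℝ}

lemma fire_pos (hz : IsRoundState p z) (h : IsTimeStep r p η) :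
    0 < η * branchRate r p z.1 * z.2 :=
  mul_pos (mul_pos h.pos (branchRate_pos (by linarith [h.three_le]) h.p_lt_one hz.fst_pos))
    hz.snd_pos

lemma fire_le (hz : IsRoundState p z) (h : IsTimeStep r p η) :
    η * branchRate r p z.1 * z.2 ≤ η * ((r : ℝ) - 1) * z.1 := by
  have hη := h.pos
  have ha := hz.fst_pos
  have hrate := branchRate_pos (by linarith [h.three_le]) h.p_lt_one ha
  calc η * branchRate r p z.1 * z.2 ≤ η * branchRate r p z.1 * 1 := by
        gcongr
        linarith [hz.add_le_one]
    _ ≤ η * (((r : ℝ) - 1) * z.1) * 1 := by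
        gcongr
        exact branchRate_le_mul h.three_le h.p_pos.le ha.le (by linarith [hz.fst_le, h.p_pos])
    _ = η * ((r : ℝ) - 1) * z.1 := by ring

end IsRoundState

namespace IsTimeStep

lemma two_le (h : IsTimeStep r p η) : 2 ≤ r := by linarith [h.three_le]

lemma lt_one (h : IsTimeStep r p η) : η < 1 := by
  have hr : (3 : ℝ) ≤ r := by exact_mod_cast h.three_le
  nlinarith [h.pos, h.mul_lt_one]

lemma isRoundState (h : IsTimeStep r p η) (i : ℕ) : IsRoundState p (roundState r p η i) := by
  induction i with
  | zero => exact ⟨sub_pos.2 h.p_lt_one, le_rfl, h.p_pos, (sub_add_cancel 1 p).le⟩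
  | succ i ih =>
    have hfire := ih.fire_pos h
    have hle := ih.fire_le h
    have hy := mul_pos h.pos ih.snd_pos
    constructor
    · change 0 < (roundState r p η i).1 - η * branchRate r p (roundState r p η i).1 * _
      nlinarith [h.mul_lt_one, ih.fst_pos]
    · exact (sub_le_self _ hfire.le).trans ih.fst_le
    · exact add_pos (mul_pos (sub_pos.2 h.lt_one) ih.snd_pos) hfire
    · refine (silence_add_pressure_succ i).trans_le ?_
      exact (sub_le_self _ hy.le).trans ih.add_le_one

lemma silence_pos (h : IsTimeStep r p η) (i : ℕ) : 0 < silence r p η i :=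
  (h.isRoundState i).fst_pos

lemma silence_le (h : IsTimeStep r p η) (i : ℕ) : silence r p η i ≤ 1 - p :=
  (h.isRoundState i).fst_le

lemma silence_le_one (h : IsTimeStep r p η) (i : ℕ) : silence r p η i ≤ 1 :=
  (h.silence_le i).trans (sub_le_self 1 h.p_pos.le)

lemma pressure_pos (h : IsTimeStep r p η) (i : ℕ) : 0 < pressure r p η i :=
  (h.isRoundState i).snd_pos

lemma silence_add_pressure_le_one (h : IsTimeStep r p η) (i : ℕ) :
    silence r p η i + pressure r p η i ≤ 1 :=
  (h.isRoundState i).add_le_one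

lemma fireProb_pos (h : IsTimeStep r p η) (i : ℕ) : 0 < fireProb r p η (i + 1) :=
  (h.isRoundState i).fire_pos h

lemma fireProb_le (h : IsTimeStep r p η) (i : ℕ) :
    fireProb r p η (i + 1) ≤ η * ((r : ℝ) - 1) * silence r p η i :=
  (h.isRoundState i).fire_le h

-- In `(a, y)`-coordinates the discrete process moves along tangents of the concave blue mass.
lemma blueMass_le_pressure (h : IsTimeStep r p η) (i : ℕ) :
    blueMass r p (silence r p η i) ≤ pressure r p η i := by
  induction i with
  | zero => rw [silence_zero, blueMass_one_sub, pressure_zero]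
  | succ i ih =>
    have hrate := (branchRate_pos h.two_le h.p_lt_one (h.silence_pos i)).ne'
    calc blueMass r p (silence r p η (i + 1))
        ≤ blueMass r p (silence r p η i) + (silence r p η i - silence r p η (i + 1)) *
            (1 - 1 / branchRate r p (silence r p η i)) :=
          blueMass_le_tangent h.two_le h.p_lt_one (h.silence_pos _) (h.silence_pos i)
      _ ≤ pressure r p η i + (silence r p η i - silence r p η (i + 1)) *
            (1 - 1 / branchRate r p (silence r p η i)) := by gcongr
      _ = pressure r p η (i + 1) := by
        rw [pressure_succ, silence_succ, fireProb]
        field_simp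
        ring

-- Otherwise the pressure would stay bounded below, but the sum of silence and pressure drops by
-- `η` times the pressure in every round.
lemma exists_silence_lt (h : IsTimeStep r p η) {α δ : ℝ} (hα : IsStop r p α) (hδ : 0 < δ) :
    ∃ N, silence r p η N < α + δ := by
  by_contra! hN
  obtain ⟨x, hx, hmin⟩ := isCompact_Icc.exists_isMinOn ⟨_, hN 0, h.silence_le 0⟩
    ((continuousOn_blueMass h.two_le h.p_lt_one).mono fun x (hx : x ∈ Set.Icc (α + δ) (1 - p)) =>
      (add_pos hα.pos hδ).trans_le hx.1)
  have hm : 0 < η * blueMass r p x :=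
    mul_pos h.pos (hα.blueMass_pos x ⟨(lt_add_of_pos_right α hδ).trans_le hx.1, hx.2⟩)
  have hmass : ∀ i, blueMass r p x ≤ pressure r p η i := fun i =>
    (hmin ⟨hN i, h.silence_le i⟩).trans (h.blueMass_le_pressure i)
  have hdec : ∀ i : ℕ, silence r p η i + pressure r p η i ≤ 1 - i * (η * blueMass r p x) := by
    intro i
    induction i with
    | zero => simpa using h.silence_add_pressure_le_one 0
    | succ i ih =>
      rw [silence_add_pressure_succ]
      push_cast
      linarith [mul_le_mul_of_nonneg_left (hmass i) h.pos.le]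
  obtain ⟨n, hn⟩ := exists_nat_gt (1 / (η * blueMass r p x))
  rw [div_lt_iff₀ hm] at hn
  linarith [hdec n, h.silence_pos n, h.pressure_pos n]

lemma mul_silence_pow_le (h : IsTimeStep r p η) (i : ℕ) :
    (1 - ((r : ℝ) - 2) * (η * ((r : ℝ) - 1))) * silence r p η i ^ (r - 2) ≤
      silence r p η (i + 1) ^ (r - 2) := by
  have hs := h.silence_pos i
  have hstep : (1 - η * ((r : ℝ) - 1)) * silence r p η i ≤ silence r p η (i + 1) := by
    rw [silence_succ]
    linarith [h.fireProb_le i]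
  have hη : 0 ≤ 1 - η * ((r : ℝ) - 1) := sub_nonneg.2 h.mul_lt_one.le
  have hbernoulli : 1 - ((r : ℝ) - 2) * (η * ((r : ℝ) - 1)) ≤
      (1 - η * ((r : ℝ) - 1)) ^ (r - 2) := by
    have hB := one_add_mul_le_pow (a := -(η * ((r : ℝ) - 1))) (by linarith) (r - 2)
    rw [Nat.cast_sub h.two_le, ← sub_eq_add_neg] at hB
    push_cast at hB
    linarith
  calc (1 - ((r : ℝ) - 2) * (η * ((r : ℝ) - 1))) * silence r p η i ^ (r - 2)
      ≤ (1 - η * ((r : ℝ) - 1)) ^ (r - 2) * silence r p η i ^ (r - 2) := by gcongr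
    _ = ((1 - η * ((r : ℝ) - 1)) * silence r p η i) ^ (r - 2) := (mul_pow _ _ _).symm
    _ ≤ silence r p η (i + 1) ^ (r - 2) := by gcongr

lemma mul_fireProb_le_purpleDensity (h : IsTimeStep r p η) (i : ℕ) :
    r / ((r : ℝ) - 1) * (fireProb r p η (i + 1) * silence r p η (i + 1) *
      (1 - ((r : ℝ) - 2) * (η * ((r : ℝ) - 1)))) ≤ purpleDensity r p η i := by
  have hr1 := cast_sub_one_pos h.two_le
  have hp := sub_pos.2 h.p_lt_one
  have hη := h.pos
  have hy := h.pressure_pos i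
  have hs := h.silence_pos (i + 1)
  calc r / ((r : ℝ) - 1) * (fireProb r p η (i + 1) * silence r p η (i + 1) *
        (1 - ((r : ℝ) - 2) * (η * ((r : ℝ) - 1))))
      = r * ((1 - p) * η * pressure r p η i) * ((1 - ((r : ℝ) - 2) * (η * ((r : ℝ) - 1))) *
          silence r p η i ^ (r - 2) * silence r p η (i + 1)) := by
        rw [fireProb, branchRate]
        field_simp
    _ ≤ r * ((1 - p) * η * pressure r p η i) *
          (silence r p η (i + 1) ^ (r - 2) * silence r p η (i + 1)) := by
        gcongr
        exact h.mul_silence_pow_le i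
    _ = purpleDensity r p η i := by
        rw [← pow_succ, purpleDensity, show r - 2 + 1 = r - 1 by have := h.three_le; lia]

lemma le_purpleDensity (h : IsTimeStep r p η) (i : ℕ) :
    r / (2 * ((r : ℝ) - 1)) * (silence r p η i ^ 2 - silence r p η (i + 1) ^ 2)
      - r ^ 2 * η * (silence r p η i - silence r p η (i + 1)) ≤ purpleDensity r p η i := by
  have hr1 := cast_sub_one_pos h.two_le
  have hr2 : (2 : ℝ) ≤ r := by exact_mod_cast h.two_le
  have hη := h.pos
  have hc := h.fireProb_pos i
  have hsucc : silence r p η i = silence r p η (i + 1) + fireProb r p η (i + 1) := by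
    rw [silence_succ, sub_add_cancel]
  have hc_le : fireProb r p η (i + 1) ≤ η * ((r : ℝ) - 1) * 1 :=
    (h.fireProb_le i).trans (by gcongr; exact h.silence_le_one i)
  set c := fireProb r p η (i + 1)
  set a := silence r p η (i + 1)
  have herr : r / ((r : ℝ) - 1) * c * (c / 2 + (r - 2) * (η * (r - 1)) * a) ≤ r ^ 2 * η * c :=
    calc r / ((r : ℝ) - 1) * c * (c / 2 + (r - 2) * (η * (r - 1)) * a)
        ≤ r / ((r : ℝ) - 1) * c * (η * (r - 1) + (r - 2) * (η * (r - 1)) * 1) := by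
          gcongr
          · linarith
          · exact h.silence_le_one (i + 1)
      _ = r * (r - 1) * η * c := by field_simp; ring
      _ ≤ r * r * η * c := by gcongr; linarith
      _ = r ^ 2 * η * c := by ring
  calc r / (2 * ((r : ℝ) - 1)) * (silence r p η i ^ 2 - a ^ 2) - r ^ 2 * η * (silence r p η i - a)
      = r / ((r : ℝ) - 1) * (c * a * (1 - (r - 2) * (η * (r - 1)))) +
          (r / ((r : ℝ) - 1) * c * (c / 2 + (r - 2) * (η * (r - 1)) * a) - r ^ 2 * η * c) := by
        rw [hsucc]
        field_simp
        ring
    _ ≤ r / ((r : ℝ) - 1) * (c * a * (1 - (r - 2) * (η * (r - 1)))) :=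
        add_le_of_nonpos_right (sub_nonpos.2 herr)
    _ ≤ purpleDensity r p η i := h.mul_fireProb_le_purpleDensity i

lemma forestDensity_silence_le (h : IsTimeStep r p η) (N : ℕ) :
    forestDensity r p (silence r p η N) - r ^ 2 * η ≤ processDensity r p η N := by
  have hsum := Finset.sum_le_sum fun i (_ : i ∈ Finset.range N) => h.le_purpleDensity i
  rw [Finset.sum_sub_distrib, ← Finset.mul_sum, ← Finset.mul_sum, Finset.sum_range_sub',
    Finset.sum_range_sub', silence_zero] at hsum
  have herr : r ^ 2 * η * ((1 - p) - silence r p η N) ≤ r ^ 2 * η * 1 := by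
    have hη := h.pos
    gcongr
    linarith [h.p_pos, h.silence_pos N]
  unfold forestDensity processDensity
  linarith

end IsTimeStep

lemma exists_processDensity_ge {α ε : ℝ} (hα : IsStop r p α) (hr : 3 ≤ r) (hp0 : 0 < p)
    (hp : p < 1) (hε : 0 < ε) : ∃ η N, IsTimeStep r p η ∧
      branchRate r p (silence r p η N) < 1 ∧ forestDensity r p α - ε ≤ processDensity r p η N := by
  have hr3 : (3 : ℝ) ≤ r := by exact_mod_cast hr
  obtain ⟨η, hη, hηε⟩ := exists_pos_mul_lt (lt_min (half_pos hε) one_pos) ((r : ℝ) ^ 2)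
  have hstep : IsTimeStep r p η :=
    ⟨hr, hp0, hp, hη, by nlinarith [hηε.trans_le (min_le_right _ _)]⟩
  have hdensity : ∀ᶠ x in 𝓝 α, forestDensity r p α - ε / 2 < forestDensity r p x :=
    (hasDerivAt_forestDensity hstep.two_le α).continuousAt.eventually_const_lt
      (sub_lt_self _ (half_pos hε))
  have hrate : ∀ᶠ x in 𝓝 α, branchRate r p x < 1 :=
    (continuous_branchRate.tendsto α).eventually_lt_const hα.branchRate_lt_one
  obtain ⟨δ, hδ, hball⟩ := Metric.eventually_nhds_iff.1 (hdensity.and hrate)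
  obtain ⟨N, hN⟩ := hstep.exists_silence_lt hα hδ
  obtain ⟨hdensityN, hrateN⟩ : forestDensity r p α - ε / 2 ≤ forestDensity r p (silence r p η N) ∧
      branchRate r p (silence r p η N) < 1 := by
    rcases le_total (silence r p η N) α with hle | hle
    · exact ⟨(sub_le_self _ (half_pos hε).le).trans
          (antitoneOn_forestDensity hstep.two_le hp.le hα.branchRate_lt_one.le
            ⟨(hstep.silence_pos N).le, hle⟩ ⟨hα.pos.le, le_rfl⟩ hle),
        (monotoneOn_branchRate (by lia) hp.le (hstep.silence_pos N).le hα.pos.le hle).trans_lt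
          hα.branchRate_lt_one⟩
    · have hdist : dist (silence r p η N) α < δ := by
        rw [Real.dist_eq, abs_of_nonneg (sub_nonneg.2 hle)]
        linarith
      exact ⟨(hball hdist).1.le, (hball hdist).2⟩
  refine ⟨η, N, hstep, hrateN, ?_⟩
  linarith [hstep.forestDensity_silence_le N, hηε.trans_le (min_le_left _ _)]

end

section

variable {V : Type*}

/-- In the process with labels `D`, where `0` marks a seed and any other label is the delay with
which a triggered vertex fires, and with the influence of `v` on `u` switched off, the vertex `u`
fires in round `i`: it is a seed and `i = 0`, or it was triggered by a unique firing neighbour. -/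
def Fires (G : SimpleGraph V) (D : V → ℕ) (i : ℕ) (u v : V) : Prop :=
  (i = 0 ∧ D u = 0) ∨ (D u ≠ 0 ∧ ∃ x, G.Adj u x ∧ x ≠ v ∧ ∃ τ : Fin i, Fires G D τ x u ∧
    τ + D u = i ∧ ∀ x', G.Adj u x' → x' ≠ v → x' ≠ x → ∀ τ' : Fin i, ¬ Fires G D τ' x' u)
termination_by i

/-- `v` turns purple in round `i`: it fires, and none of its neighbours other than the one that
triggers it fires up to that round. -/
def PurpleAt (G : SimpleGraph V) (D : V → ℕ) (i : ℕ) (v : V) : Prop :=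
  (i = 0 ∧ D v = 0 ∧ ∀ x, G.Adj v x → D x ≠ 0) ∨
  (D v ≠ 0 ∧ ∃ x, G.Adj v x ∧ ∃ τ < i, Fires G D τ x v ∧ τ + D v = i ∧
    ∀ x', G.Adj v x' → x' ≠ x → ∀ τ' ≤ i, ¬ Fires G D τ' x' v)

/-- `v` is not a seed and none of its neighbours fires up to round `N`. -/
def White (G : SimpleGraph V) (D : V → ℕ) (N : ℕ) (v : V) : Prop :=
  D v ≠ 0 ∧ ∀ x, G.Adj v x → ∀ τ ≤ N, ¬ Fires G D τ x v

/-- Some vertex of `T` has at most one neighbour in `T`. -/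
def HasLeaf (G : SimpleGraph V) (T : Finset V) : Prop :=
  ∃ z ∈ T, ∀ x ∈ T, ∀ y ∈ T, G.Adj z x → G.Adj z y → x = y

/-- The forest that the process grows in `N` rounds: the purple vertices, and the white vertices
that lie in no subgraph of minimum degree two made of white vertices. -/
def grownForest (G : SimpleGraph V) (D : V → ℕ) (N : ℕ) : Set V :=
  {v | ∃ i ≤ N, PurpleAt G D i v} ∪
  {v | White G D N v ∧ ∀ T : Finset V, v ∈ T → (∀ x ∈ T, White G D N x) → HasLeaf G T}

variable {G : SimpleGraph V} {D : V → ℕ} {N : ℕ}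

lemma fires_iff {i : ℕ} {u v : V} : Fires G D i u v ↔
    (i = 0 ∧ D u = 0) ∨ (D u ≠ 0 ∧ ∃ x, G.Adj u x ∧ x ≠ v ∧ ∃ τ < i, Fires G D τ x u ∧
      τ + D u = i ∧ ∀ x', G.Adj u x' → x' ≠ v → x' ≠ x → ∀ τ' < i, ¬ Fires G D τ' x' u) := by
  rw [Fires]
  simp only [Fin.exists_iff, Fin.forall_iff, exists_prop]

lemma fires_zero_iff {u v : V} : Fires G D 0 u v ↔ D u = 0 := by
  rw [fires_iff]
  simp

lemma Fires.unique {i : ℕ} : ∀ {j : ℕ} {u v : V}, Fires G D i u v → Fires G D j u v → i = j := by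
  induction i using Nat.strong_induction_on with
  | _ i ih =>
    intro j u v hi hj
    rw [fires_iff] at hi hj
    rcases hi with ⟨rfl, hseed⟩ | ⟨hnot, x, hadj, hne, τ, hτ, hfire, hsum, hothers⟩
    · rcases hj with ⟨rfl, -⟩ | ⟨hnot, -⟩
      · rfl
      · exact absurd hseed hnot
    · rcases hj with ⟨-, hseed⟩ | ⟨-, x', hadj', hne', τ', hτ', hfire', hsum', hothers'⟩
      · exact absurd hseed hnot
      · obtain rfl | hx := eq_or_ne x x'
        · rw [← hsum, ← hsum', ih τ hτ hfire hfire']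
        · rcases le_total i j with hij | hij
          · exact absurd hfire (hothers' x hadj hne hx τ (hτ.trans_le hij))
          · exact absurd hfire' (hothers x' hadj' hne' hx.symm τ' (hτ'.trans_le hij))

namespace PurpleAt

lemma unique {i j : ℕ} {v : V} (hi : PurpleAt G D i v) (hj : PurpleAt G D j v) : i = j := by
  rcases hi with ⟨rfl, hseed, -⟩ | ⟨hnot, x, hadj, τ, hτ, hfire, hsum, hothers⟩
  · rcases hj with ⟨rfl, -⟩ | ⟨hnot, -⟩
    · rfl
    · exact absurd hseed hnot
  · rcases hj with ⟨-, hseed, -⟩ | ⟨-, x', hadj', τ', hτ', hfire', hsum', hothers'⟩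
    · exact absurd hseed hnot
    · obtain rfl | hx := eq_or_ne x x'
      · rw [← hsum, ← hsum', hfire.unique hfire']
      · rcases le_total i j with hij | hij
        · exact absurd hfire (hothers' x hadj hx τ (hτ.le.trans hij))
        · exact absurd hfire' (hothers x' hadj' hx.symm τ' (hτ'.le.trans hij))

lemma fires {i : ℕ} {v x : V} (h : PurpleAt G D i v) (hx : ∀ τ ≤ i, ¬ Fires G D τ x v) :
    Fires G D i v x := by
  rw [fires_iff]
  rcases h with ⟨hi, hseed, -⟩ | ⟨hnot, y, hadj, τ, hτ, hfire, hsum, hothers⟩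
  · exact Or.inl ⟨hi, hseed⟩
  · have hyx : y ≠ x := by
      rintro rfl
      exact hx τ hτ.le hfire
    exact Or.inr ⟨hnot, y, hadj, hyx, τ, hτ, hfire, hsum,
      fun x' hadj' _ hne τ' hτ' => hothers x' hadj' hne τ' hτ'.le⟩

lemma exists_trigger {j τ : ℕ} {u v : V} (h : PurpleAt G D j u) (hv : G.Adj u v)
    (hfire : Fires G D τ v u) (hτ : τ ≤ j) :
    D u ≠ 0 ∧ τ < j ∧ ∀ v', G.Adj u v' → v' ≠ v → ∀ τ' ≤ j, ¬ Fires G D τ' v' u := by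
  rcases h with ⟨rfl, -, hseeds⟩ | ⟨hnot, y, hadj, σ, hσ, hfire', -, hothers⟩
  · obtain rfl := Nat.le_zero.1 hτ
    exact absurd (fires_zero_iff.1 hfire) (hseeds v hv)
  · obtain rfl : v = y := by
      by_contra hne
      exact hothers v hv hne τ hτ hfire
    exact ⟨hnot, hfire.unique hfire' ▸ hσ, hothers⟩

lemma parent_unique {j τ τ' : ℕ} {u v v' : V} (h : PurpleAt G D j u) (hv : G.Adj u v)
    (hv' : G.Adj u v') (hfire : Fires G D τ v u) (hτ : τ ≤ j) (hfire' : Fires G D τ' v' u)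
    (hτ' : τ' ≤ j) : v = v' := by
  by_contra hne
  exact (h.exists_trigger hv hfire hτ).2.2 v' hv' (Ne.symm hne) τ' hτ' hfire'

lemma lt_of_fires_back {i σ τ : ℕ} {u v : V} (h : PurpleAt G D i v) (hu : G.Adj v u)
    (hfire : Fires G D σ u v) (hσ : σ ≤ i) (hback : Fires G D τ v u) : i < τ := by
  obtain ⟨hnot, -, hothers⟩ := h.exists_trigger hu hfire hσ
  rw [fires_iff] at hback
  rcases hback with ⟨-, hseed⟩ | ⟨-, x, hadj, hne, ρ, hρ, hfire', -⟩
  · exact absurd hseed hnot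
  · by_contra! hle
    exact hothers x hadj hne ρ (hρ.le.trans hle) hfire'

lemma lt_or_lt {i j : ℕ} {u v : V} (hv : PurpleAt G D i v) (hu : PurpleAt G D j u)
    (huv : G.Adj u v) : (Fires G D i v u ∧ i < j) ∨ (Fires G D j u v ∧ j < i) := by
  by_cases hvu : ∃ τ ≤ j, Fires G D τ v u
  · obtain ⟨τ, hτ, hfire⟩ := hvu
    have hlt := (hu.exists_trigger huv hfire hτ).2.1
    by_cases huv' : ∃ σ ≤ i, Fires G D σ u v
    · obtain ⟨σ, hσ, hfire'⟩ := huv'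
      have hσi := (hv.exists_trigger huv.symm hfire' hσ).2.1
      have hiτ := hv.lt_of_fires_back huv.symm hfire' hσ hfire
      have hjσ := hu.lt_of_fires_back huv hfire hτ hfire'
      lia
    · push Not at huv'
      have hfire' := hv.fires huv'
      exact Or.inl ⟨hfire', hfire'.unique hfire ▸ hlt⟩
  · push Not at hvu
    have hfire := hu.fires hvu
    by_cases huv' : ∃ σ ≤ i, Fires G D σ u v
    · obtain ⟨σ, hσ, hfire'⟩ := huv'
      have hlt := (hv.exists_trigger huv.symm hfire' hσ).2.1
      exact Or.inr ⟨hfire, hfire.unique hfire' ▸ hlt⟩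
    · push Not at huv'
      rcases le_total i j with hij | hij
      · exact absurd (hv.fires huv') (hvu i hij)
      · exact absurd hfire (huv' j hij)

end PurpleAt

lemma White.not_adj_purple {i : ℕ} {u v : V} (hv : White G D N v) (hu : PurpleAt G D i u)
    (hi : i ≤ N) : ¬ G.Adj u v := by
  intro huv
  by_cases hvu : ∃ τ ≤ i, Fires G D τ v u
  · obtain ⟨τ, hτ, hfire⟩ := hvu
    rw [fires_iff] at hfire
    rcases hfire with ⟨-, hseed⟩ | ⟨-, x, hadj, -, ρ, hρ, hfire', -⟩
    · exact hv.1 hseed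
    · exact hv.2 x hadj ρ (hρ.le.trans (hτ.trans hi)) hfire'
  · push Not at hvu
    exact hv.2 u huv.symm i hi (hu.fires hvu)

lemma White.not_purple {i : ℕ} {v : V} (hv : White G D N v) (hi : i ≤ N) :
    ¬ PurpleAt G D i v := by
  rintro (⟨-, hseed, -⟩ | ⟨-, x, hadj, τ, hτ, hfire, -⟩)
  · exact hv.1 hseed
  · exact hv.2 x hadj τ (hτ.le.trans hi) hfire

lemma isAcyclic_induce_of_hasLeaf {S : Set V}
    (h : ∀ T : Finset V, (T : Set V) ⊆ S → T.Nonempty → HasLeaf G T) : (G.induce S).IsAcyclic := by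
  classical
  intro v c hc
  set T := c.support.toFinset.image Subtype.val with hT
  have hTS : (T : Set V) ⊆ S := fun x hx => by
    obtain ⟨y, -, rfl⟩ := Finset.mem_image.1 hx
    exact y.2
  obtain ⟨z, hz, hleaf⟩ := h T hTS ⟨v, by simp [hT]⟩
  obtain ⟨z, hzs, rfl⟩ := Finset.mem_image.1 hz
  have hmem : ∀ w, c.toSubgraph.Adj z w → (w : V) ∈ T := fun w hw =>
    Finset.mem_image_of_mem _ (List.mem_toFinset.2 (c.mem_verts_toSubgraph.1 hw.snd_mem))
  obtain ⟨x, y, hxy, hnbr⟩ := Set.ncard_eq_two.1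
    (hc.ncard_neighborSet_toSubgraph_eq_two (List.mem_toFinset.1 hzs))
  have hx : c.toSubgraph.Adj z x := hnbr.ge (Set.mem_insert x {y})
  have hy : c.toSubgraph.Adj z y := hnbr.ge (Set.mem_insert_of_mem x rfl)
  exact hxy (Subtype.ext (hleaf x (hmem x hx) y (hmem y hy) hx.adj_sub hy.adj_sub))

/-- The leaf is a purple vertex of `T` that fires last, after all its neighbours in `T`. -/
lemma hasLeaf_of_purple {T : Finset V} (hT : (T : Set V) ⊆ grownForest G D N) {v : V}
    (hv : v ∈ T) {i : ℕ} (hi : i ≤ N) (hvi : PurpleAt G D i v) : HasLeaf G T := by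
  classical
  set P := T.filter fun v => ∃ i ≤ N, PurpleAt G D i v
  have hpurple : ∀ v, ∃ i, v ∈ P → i ≤ N ∧ PurpleAt G D i v := fun v => by
    by_cases hv : v ∈ P
    · obtain ⟨i, hi⟩ := (Finset.mem_filter.1 hv).2
      exact ⟨i, fun _ => hi⟩
    · exact ⟨0, fun h => absurd h hv⟩
  choose time htime using hpurple
  obtain ⟨u, hu, hmax⟩ := P.exists_max_image time ⟨v, Finset.mem_filter.2 ⟨hv, i, hi, hvi⟩⟩
  obtain ⟨hN, hpu⟩ := htime u hu
  have hparent : ∀ x ∈ T, G.Adj u x → Fires G D (time x) x u ∧ time x < time u := by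
    intro x hx hux
    have hxP : x ∈ P := (hT hx).elim (fun h => Finset.mem_filter.2 ⟨hx, h⟩)
      fun h => absurd hux (h.1.not_adj_purple hpu hN)
    exact ((htime x hxP).2.lt_or_lt hpu hux).resolve_right fun h => (hmax x hxP).not_gt h.2
  refine ⟨u, (Finset.mem_filter.1 hu).1, fun x hx y hy hux huy => ?_⟩
  obtain ⟨hfx, hltx⟩ := hparent x hx hux
  obtain ⟨hfy, hlty⟩ := hparent y hy huy
  exact hpu.parent_unique hux huy hfx hltx.le hfy hlty.le

theorem isAcyclic_grownForest : (G.induce (grownForest G D N)).IsAcyclic := by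
  refine isAcyclic_induce_of_hasLeaf fun T hT ⟨v, hv⟩ => ?_
  by_cases hpurple : ∃ u ∈ T, ∃ i ≤ N, PurpleAt G D i u
  · obtain ⟨u, hu, i, hi, hui⟩ := hpurple
    exact hasLeaf_of_purple hT hu hi hui
  · have hwhite := fun u hu => (hT hu).resolve_left fun h => hpurple ⟨u, hu, h⟩
    exact (hwhite v hv).2 T hv fun u hu => (hwhite u hu).1

end

section

variable {V ι : Type*}

lemma dependsOn_inter {A B : Set (V → ℕ)} {S T : Set V}
    (hA : DependsOn (· ∈ A) S) (hB : DependsOn (· ∈ B) T) : DependsOn (· ∈ A ∩ B) (S ∪ T) :=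
  fun _ _ h => congrArg₂ And (hA fun i hi => h i (Or.inl hi)) (hB fun i hi => h i (Or.inr hi))

lemma dependsOn_biInter {X : Set ι} {A : ι → Set (V → ℕ)} {S : ι → Set V}
    (hA : ∀ x ∈ X, DependsOn (· ∈ A x) (S x)) :
    DependsOn (· ∈ ⋂ x ∈ X, A x) (⋃ x ∈ X, S x) := by
  intro ω ω' h
  simp only [Set.mem_iInter, eq_iff_iff]
  exact forall₂_congr fun x hx => iff_of_eq (hA x hx fun i hi => h i (Set.mem_biUnion hx hi))

lemma dependsOn_label (y : V) (s : Set ℕ) : DependsOn (· ∈ {ω : V → ℕ | ω y ∈ s}) {y} := by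
  intro ω ω' h
  simp only [Set.mem_ofPred_eq, h y rfl]

/-- The event that no branch in `Y` fires before round `j`. -/
def silentSet (E : ι → ℕ → Set (V → ℕ)) (j : ℕ) (Y : Set ι) : Set (V → ℕ) :=
  {ω | ∀ x ∈ Y, ∀ τ < j, ω ∉ E x τ}

/-- The event that some branch triggers `y` to turn purple in round `i` while all other branches
are silent before round `j`. -/
def triggerSet (E : ι → ℕ → Set (V → ℕ)) (y : V) (X : Finset ι) (i j : ℕ) : Set (V → ℕ) :=
  {ω | ∃ x ∈ X, ∃ τ < i, ω ∈ E x τ ∧ τ + ω y = i ∧ ω ∈ silentSet E j (X \ {x})}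

lemma silentSet_eq_biInter {E : ι → ℕ → Set (V → ℕ)} {j : ℕ} {X : Finset ι} :
    silentSet E j X = ⋂ x ∈ X, silentSet E j {x} := by
  ext ω
  simp [silentSet]

lemma triggerSet_eq_biUnion {E : ι → ℕ → Set (V → ℕ)} {y : V} {X : Finset ι} {i j : ℕ} :
    triggerSet E y X i j = ⋃ q ∈ X ×ˢ Finset.range i,
      {ω : V → ℕ | ω y ∈ ({i - q.2} : Set ℕ)} ∩ (E q.1 q.2 ∩ silentSet E j (X \ {q.1})) := by
  ext ω
  simp only [triggerSet, Set.mem_ofPred_eq, Set.mem_iUnion, Finset.mem_product, Finset.mem_range,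
    Set.mem_inter_iff, Set.mem_singleton_iff, exists_prop, Prod.exists]
  constructor
  · rintro ⟨x, hx, τ, hτ, hfire, hsum, hsilent⟩
    exact ⟨x, τ, ⟨hx, hτ⟩, by lia, hfire, hsilent⟩
  · rintro ⟨x, τ, ⟨hx, hτ⟩, hlabel, hfire, hsilent⟩
    exact ⟨x, hx, τ, hτ, hfire, by lia, hsilent⟩

/-- The law of independent vertex labels with common law `ν`. -/
abbrev labelMeasure (V : Type*) [Fintype V] (ν : Measure ℕ) : Measure (V → ℕ) :=
  Measure.pi fun _ => ν

variable [Fintype V] {ν : Measure ℕ}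

section

variable [IsProbabilityMeasure ν]

lemma measureReal_inter_of_dependsOn {A B : Set (V → ℕ)} {S T : Set V}
    (hA : DependsOn (· ∈ A) S) (hB : DependsOn (· ∈ B) T) (hST : Disjoint S T) :
    (labelMeasure V ν).real (A ∩ B) = (labelMeasure V ν).real A * (labelMeasure V ν).real B := by
  classical
  let extend (S : Set V) (x : S.toFinset → ℕ) : V → ℕ :=
    fun i => if h : i ∈ S.toFinset then x ⟨i, h⟩ else 0
  have hpreimage : ∀ {A : Set (V → ℕ)} {S : Set V}, DependsOn (· ∈ A) S →
      (fun (ω : V → ℕ) (i : S.toFinset) => ω i) ⁻¹' (extend S ⁻¹' A) = A := by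
    intro A S hA
    ext ω
    refine iff_of_eq (hA fun i hi => ?_)
    simp [extend, hi]
  have hind := (ProbabilityTheory.iIndepFun_pi (X := fun _ : V => id)
    fun _ => aemeasurable_id (μ := ν)).indepFun_finset S.toFinset T.toFinset (by simpa using hST)
    fun i => measurable_pi_apply i
  have hmul := hind.measure_inter_preimage_eq_mul (extend S ⁻¹' A) (extend T ⁻¹' B) .of_discrete
    .of_discrete
  simp only [id_eq] at hmul
  rw [hpreimage hA, hpreimage hB] at hmul
  simp only [Measure.real, hmul, ENNReal.toReal_mul]

lemma measureReal_biInter_of_dependsOn {X : Finset ι} {A : ι → Set (V → ℕ)} {S : ι → Set V}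
    (hA : ∀ x ∈ X, DependsOn (· ∈ A x) (S x)) (hS : (X : Set ι).PairwiseDisjoint S) :
    (labelMeasure V ν).real (⋂ x ∈ X, A x) = ∏ x ∈ X, (labelMeasure V ν).real (A x) := by
  classical
  induction X using Finset.induction_on with
  | empty => simp
  | insert a X ha ih =>
    have hAX : ∀ x ∈ (X : Set ι), DependsOn (· ∈ A x) (S x) :=
      fun x hx => hA x (Finset.mem_insert_of_mem hx)
    have hdisj : Disjoint (S a) (⋃ x ∈ (X : Set ι), S x) :=
      Set.disjoint_iUnion₂_right.2 fun x hx => hS (by simp) (by simp [Finset.mem_coe.1 hx])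
        fun h => ha (h ▸ hx)
    rw [Finset.prod_insert ha, Finset.set_biInter_insert, ← ih hAX (hS.subset (by simp))]
    exact measureReal_inter_of_dependsOn (hA a (Finset.mem_insert_self a X))
      (dependsOn_biInter hAX) hdisj

lemma measureReal_label (y : V) (s : Set ℕ) :
    (labelMeasure V ν).real {ω | ω y ∈ s} = ν.real s :=
  congrArg ENNReal.toReal ((measurePreserving_eval (fun _ : V => ν) y).measure_preimage
    (MeasurableSet.of_discrete (s := s)).nullMeasurableSet)

end

/-- The branches `x ∈ X` at a vertex `y`: before round `j`, the branch `x` fires at most once, and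
the event `E x τ` that it does so in round `τ` has probability `c τ` and depends only on the labels
in `S x`. -/
structure Branches (ν : Measure ℕ) (y : V) (X : Finset ι) (S : ι → Set V) (E : ι → ℕ → Set (V → ℕ))
    (c : ℕ → ℝ) (j : ℕ) : Prop where
  dependsOn : ∀ x ∈ X, ∀ τ < j, DependsOn (· ∈ E x τ) (S x)
  pairwiseDisjoint : (X : Set ι).PairwiseDisjoint S
  notMem : ∀ x ∈ X, y ∉ S x
  prob_fire : ∀ x ∈ X, ∀ τ < j, (labelMeasure V ν).real (E x τ) = c τ
  fire_once : ∀ x ∈ X, Pairwise (Function.onFun Disjoint (E x))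

namespace Branches

variable {y : V} {X Y : Finset ι} {S : ι → Set V} {E : ι → ℕ → Set (V → ℕ)} {c : ℕ → ℝ} {j : ℕ}

lemma mono (h : Branches ν y X S E c j) (hY : Y ⊆ X) : Branches ν y Y S E c j where
  dependsOn x hx := h.dependsOn x (hY hx)
  pairwiseDisjoint := h.pairwiseDisjoint.subset hY
  notMem x hx := h.notMem x (hY hx)
  prob_fire x hx := h.prob_fire x (hY hx)
  fire_once x hx := h.fire_once x (hY hx)

lemma dependsOn_silentSet_singleton (h : Branches ν y X S E c j) {x : ι} (hx : x ∈ X) :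
    DependsOn (· ∈ silentSet E j {x}) (S x) := by
  intro ω ω' hω
  simp only [silentSet, Set.mem_singleton_iff, forall_eq, Set.mem_ofPred_eq, eq_iff_iff]
  exact forall₂_congr fun τ hτ => not_congr (iff_of_eq (h.dependsOn x hx τ hτ hω))

lemma dependsOn_silentSet (h : Branches ν y X S E c j) :
    DependsOn (· ∈ silentSet E j X) (⋃ x ∈ (X : Set ι), S x) := by
  rw [silentSet_eq_biInter]
  exact dependsOn_biInter fun x hx => h.dependsOn_silentSet_singleton hx

lemma disjoint_label (h : Branches ν y X S E c j) : Disjoint {y} (⋃ x ∈ (X : Set ι), S x) := by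
  simpa using h.notMem

variable [IsProbabilityMeasure ν]

lemma prob_silentSet_singleton (h : Branches ν y X S E c j) {x : ι} (hx : x ∈ X) :
    (labelMeasure V ν).real (silentSet E j {x}) = 1 - ∑ τ ∈ Finset.range j, c τ := by
  have hcompl : silentSet E j {x} = (⋃ τ ∈ Finset.range j, E x τ)ᶜ := by
    ext ω
    simp [silentSet]
  rw [hcompl, probReal_compl_eq_one_sub .of_discrete, measureReal_biUnion_finset
    (fun τ _ τ' _ hne => h.fire_once x hx hne) fun _ _ => .of_discrete]
  exact congrArg _ (Finset.sum_congr rfl fun τ hτ => h.prob_fire x hx τ (Finset.mem_range.1 hτ))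

lemma prob_silentSet (h : Branches ν y X S E c j) : (labelMeasure V ν).real (silentSet E j X) =
    (1 - ∑ τ ∈ Finset.range j, c τ) ^ X.card := by
  rw [silentSet_eq_biInter, measureReal_biInter_of_dependsOn
    (fun x hx => h.dependsOn_silentSet_singleton hx) h.pairwiseDisjoint]
  exact Finset.prod_eq_pow_card fun x hx => h.prob_silentSet_singleton hx

lemma prob_label_inter_silentSet (h : Branches ν y X S E c j) (s : Set ℕ) :
    (labelMeasure V ν).real ({ω | ω y ∈ s} ∩ silentSet E j X) =
      ν.real s * (1 - ∑ τ ∈ Finset.range j, c τ) ^ X.card := by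
  rw [measureReal_inter_of_dependsOn (dependsOn_label y s) h.dependsOn_silentSet h.disjoint_label,
    measureReal_label, h.prob_silentSet]

lemma prob_label_inter_inter_silentSet (h : Branches ν y X S E c j) {x : ι} (hx : x ∈ X)
    (s : Set ℕ) {A : Set (V → ℕ)} (hA : DependsOn (· ∈ A) (S x)) :
    (labelMeasure V ν).real ({ω | ω y ∈ s} ∩ (A ∩ silentSet E j (X \ {x}))) =
      ν.real s * (labelMeasure V ν).real A
        * (1 - ∑ τ ∈ Finset.range j, c τ) ^ (X.card - 1) := by
  classical
  have herase := h.mono (Finset.erase_subset x X)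
  have hlabel : Disjoint {y} (S x ∪ ⋃ x' ∈ (X.erase x : Set ι), S x') :=
    Set.disjoint_union_right.2 ⟨by simpa using h.notMem x hx, herase.disjoint_label⟩
  have hbranch : Disjoint (S x) (⋃ x' ∈ (X.erase x : Set ι), S x') :=
    Set.disjoint_iUnion₂_right.2 fun x' hx' => h.pairwiseDisjoint hx
      (Finset.mem_of_mem_erase hx') (Finset.ne_of_mem_erase hx').symm
  rw [← Finset.coe_erase, measureReal_inter_of_dependsOn (dependsOn_label y s)
      (dependsOn_inter hA herase.dependsOn_silentSet) hlabel,
    measureReal_inter_of_dependsOn hA herase.dependsOn_silentSet hbranch, measureReal_label,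
    herase.prob_silentSet, Finset.card_erase_of_mem hx, mul_assoc]

lemma prob_triggerSet (h : Branches ν y X S E c j) {i : ℕ} (hij : i ≤ j) :
    (labelMeasure V ν).real (triggerSet E y X i j) =
      X.card * (∑ τ ∈ Finset.range i, ν.real {i - τ} * c τ)
        * (1 - ∑ τ ∈ Finset.range j, c τ) ^ (X.card - 1) := by
  have hlt : ∀ q ∈ X ×ˢ Finset.range i, q.1 ∈ X ∧ q.2 < j := fun q hq =>
    ⟨(Finset.mem_product.1 hq).1, (Finset.mem_range.1 (Finset.mem_product.1 hq).2).trans_le hij⟩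
  rw [triggerSet_eq_biUnion, measureReal_biUnion_finset ?_ fun _ _ => .of_discrete]
  · calc _ = ∑ q ∈ X ×ˢ Finset.range i,
          ν.real {i - q.2} * c q.2 * (1 - ∑ τ ∈ Finset.range j, c τ) ^ (X.card - 1) := by
          refine Finset.sum_congr rfl fun q hq => ?_
          obtain ⟨hx, hτ⟩ := hlt q hq
          rw [h.prob_label_inter_inter_silentSet hx _ (h.dependsOn q.1 hx q.2 hτ),
            h.prob_fire q.1 hx q.2 hτ]
      _ = _ := by
          rw [← Finset.sum_mul, Finset.sum_product]
          simp
  · intro q hq q' _ hne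
    obtain ⟨hx, hτ⟩ := hlt q hq
    rw [Function.onFun, Set.disjoint_left]
    rintro ω ⟨-, hfire, -⟩ ⟨-, hfire', hsilent'⟩
    by_cases hxx : q.1 = q'.1
    · have hττ : q.2 ≠ q'.2 := fun h => hne (Prod.ext hxx h)
      exact Set.disjoint_left.1 (h.fire_once q.1 hx hττ) hfire (hxx ▸ hfire')
    · exact hsilent' q.1 ⟨hx, hxx⟩ q.2 hτ hfire

end Branches

end

section

variable {V : Type*}

/-- The ball of radius `g` around `v` is a tree: `h` is the distance from `v` and `par` maps a
vertex to its parent, where the root is its own parent. -/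
structure Rooting (G : SimpleGraph V) (v : V) (g : ℕ) (h : V → ℕ) (par : V → V) : Prop where
  root : h v = 0
  par_root : par v = v
  adj : ∀ z w, h z < g → G.Adj z w → (h w = h z + 1 ∧ par w = z) ∨ (h z = h w + 1 ∧ par z = w)
  par_adj : ∀ z, 0 < h z → h z ≤ g → G.Adj z (par z)

/-- The descendants of `y` in the tree given by the distances `h` and the parents `par`. -/
def below (h : V → ℕ) (par : V → V) (y : V) : Set V := {z | ∃ j, par^[j] z = y ∧ h z = h y + j}

/-- There is a chain of `k` vertices going down from `y`, none of them a seed, such that all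
branches off the chain are silent up to round `N`. -/
def WhiteChain (G : SimpleGraph V) (D : V → ℕ) (N : ℕ) (par : V → V) : ℕ → V → Prop
  | 0, _ => True
  | k + 1, y => D y ≠ 0 ∧ ∃ x, (G.Adj y x ∧ x ≠ par y) ∧ WhiteChain G D N par k x ∧
      ∀ x', G.Adj y x' ∧ x' ≠ par y → x' ≠ x → ∀ τ ≤ N, ¬ Fires G D τ x' y

/-- The event that the branch `x` at `y` fires in round `τ`. -/
def fireSet (G : SimpleGraph V) (y x : V) (τ : ℕ) : Set (V → ℕ) := {ω | Fires G ω τ x y}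

variable {G : SimpleGraph V} {v : V} {g : ℕ} {h : V → ℕ} {par : V → V}

lemma self_mem_below (y : V) : y ∈ below h par y := ⟨0, rfl, rfl⟩

lemma below_subset {x y : V} (hx : h x = h y + 1) (hp : par x = y) :
    below h par x ⊆ below h par y := by
  rintro z ⟨j, hj, hz⟩
  exact ⟨j + 1, by rw [Function.iterate_succ_apply', hj, hp], by lia⟩

lemma notMem_below {x y : V} (hx : h x = h y + 1) : y ∉ below h par x := by
  rintro ⟨j, -, hj⟩
  lia

lemma disjoint_below {x y : V} (hxy : h x = h y) (hne : x ≠ y) :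
    Disjoint (below h par x) (below h par y) := by
  rw [Set.disjoint_left]
  rintro z ⟨j, hj, hz⟩ ⟨j', hj', hz'⟩
  obtain rfl : j = j' := by lia
  exact hne (hj.symm.trans hj')

namespace Rooting

lemma kid (R : Rooting G v g h par) {x y : V} (hy : h y < g) (hx : G.Adj y x ∧ x ≠ par y) :
    h x = h y + 1 ∧ par x = y :=
  (R.adj y x hy hx.1).resolve_right fun h => hx.2 h.2.symm

lemma dependsOn_fireSet_par (R : Rooting G v g h par) (i : ℕ) : ∀ y, h y + i ≤ g →
    DependsOn (· ∈ fireSet G (par y) y i) (below h par y) := by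
  induction i using Nat.strong_induction_on with
  | _ i ih =>
    intro y hyi ω ω' hω
    have hy : ω y = ω' y := hω y (self_mem_below y)
    have hkid : ∀ x, G.Adj y x → x ≠ par y → ∀ τ < i, (Fires G ω τ x y ↔ Fires G ω' τ x y) := by
      intro x hadj hne τ hτ
      obtain ⟨hx, hpar⟩ := R.kid (by lia) ⟨hadj, hne⟩
      have hdep := ih τ hτ x (by lia) fun z hz => hω z (below_subset hx hpar hz)
      rw [hpar] at hdep
      exact iff_of_eq hdep
    simp only [fireSet, Set.mem_ofPred_eq, eq_iff_iff]
    rw [fires_iff, fires_iff, hy]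
    refine or_congr_right (and_congr_right fun _ => exists_congr fun x =>
      and_congr_right fun hadj => and_congr_right fun hne => exists_congr fun τ =>
      and_congr_right fun hτ => and_congr (hkid x hadj hne τ hτ) (and_congr_right fun _ => ?_))
    exact forall₃_congr fun x' hadj' hne' => imp_congr_right fun _ => forall₂_congr fun τ' hτ' =>
      not_congr (hkid x' hadj' hne' τ' hτ')

lemma dependsOn_fireSet (R : Rooting G v g h par) {x y : V} {i : ℕ} (hy : h y + i < g)
    (hx : G.Adj y x ∧ x ≠ par y) : DependsOn (· ∈ fireSet G y x i) (below h par x) := by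
  obtain ⟨hxy, hpar⟩ := R.kid (by lia) hx
  have hdep := R.dependsOn_fireSet_par i x (by lia)
  rwa [hpar] at hdep

lemma dependsOn_whiteChain (R : Rooting G v g h par) {N : ℕ} (k : ℕ) : ∀ y,
    h y + k + N ≤ g → DependsOn (· ∈ {ω | WhiteChain G ω N par k y}) (below h par y) := by
  induction k with
  | zero =>
    intro y _ ω ω' _
    simp [WhiteChain]
  | succ k ih =>
    intro y hy ω ω' hω
    have hkid : ∀ x, G.Adj y x ∧ x ≠ par y →
        h x = h y + 1 ∧ ∀ z ∈ below h par x, ω z = ω' z := by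
      intro x hx
      obtain ⟨hxy, hpar⟩ := R.kid (by lia) hx
      exact ⟨hxy, fun z hz => hω z (below_subset hxy hpar hz)⟩
    simp only [Set.mem_ofPred_eq, eq_iff_iff, WhiteChain]
    rw [hω y (self_mem_below y)]
    refine and_congr_right fun _ => exists_congr fun x => and_congr_right fun hx =>
      and_congr ?_ (forall₂_congr fun x' hx' => imp_congr_right fun _ => forall₂_congr fun τ hτ =>
        not_congr ?_)
    · obtain ⟨hxy, hωx⟩ := hkid x hx
      exact iff_of_eq (ih x (by lia) hωx)
    · exact iff_of_eq (R.dependsOn_fireSet (by lia) hx' (hkid x' hx').2)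

lemma whiteChain_of_not_hasLeaf (R : Rooting G v g h par) {D : V → ℕ} {N : ℕ}
    {T : Finset V} (hW : ∀ x ∈ T, White G D N x) (hT : ¬ HasLeaf G T) (k : ℕ) : ∀ y ∈ T,
    h y + k ≤ g → WhiteChain G D N par k y := by
  have hkid : ∀ y ∈ T, ∃ x ∈ T, G.Adj y x ∧ x ≠ par y := by
    intro y hy
    by_contra! hno
    refine hT ⟨y, hy, fun x hx z hz hyx hyz => ?_⟩
    rw [hno x hx hyx, hno z hz hyz]
  induction k with
  | zero => exact fun _ _ _ => trivial
  | succ k ih =>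
    intro y hy hyk
    obtain ⟨x, hx, hxy⟩ := hkid y hy
    have hheight := (R.kid (by lia) hxy).1
    exact ⟨(hW y hy).1, x, hxy, ih x hx (by lia), fun x' hx' _ => (hW y hy).2 x' hx'.1⟩

end Rooting

variable [Fintype V]

open Classical in
/-- The neighbours of `y` other than its parent. -/
def kids (G : SimpleGraph V) (par : V → V) (y : V) : Finset V :=
  Finset.univ.filter fun x => G.Adj y x ∧ x ≠ par y

lemma mem_kids {x y : V} : x ∈ kids G par y ↔ G.Adj y x ∧ x ≠ par y := by simp [kids]

lemma coe_kids (y : V) : (kids G par y : Set V) = G.neighborSet y \ {par y} := by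
  ext x
  simp [mem_kids]

variable {ν : Measure ℕ} {r : ℕ} {p η : ℝ}

lemma prob_nonseed [IsProbabilityMeasure ν] (hν : ∀ k, ν.real {k} = labelProb p η k) :
    ν.real {0}ᶜ = 1 - p := by
  rw [probReal_compl_eq_one_sub (MeasurableSet.singleton 0), hν, labelProb]

namespace Rooting

lemma mem_kids_root (R : Rooting G v g h par) {x : V} : x ∈ kids G par v ↔ G.Adj v x := by
  rw [mem_kids, R.par_root]
  exact ⟨And.left, fun hx => ⟨hx, hx.ne'⟩⟩

lemma card_kids_root (R : Rooting G v g h par) (hdeg : ∀ y, (G.neighborSet y).ncard = r) :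
    (kids G par v).card = r := by
  rw [← hdeg v, ← Set.ncard_coe_finset]
  congr 1
  ext x
  exact R.mem_kids_root

lemma card_kids_add_one (R : Rooting G v g h par) (hdeg : ∀ y, (G.neighborSet y).ncard = r)
    {y : V} (hy : 0 < h y) (hyg : h y ≤ g) : (kids G par y).card + 1 = r := by
  rw [← Set.ncard_coe_finset, coe_kids, ← hdeg y]
  exact Set.ncard_sdiff_singleton_add_one (R.par_adj y hy hyg)

lemma branches_of_prob_fireSet (R : Rooting G v g h par) {y : V} {j : ℕ} (hy : h y < g)
    (hyj : h y + j ≤ g)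
    (hprob : ∀ τ < j, ∀ x, 0 < h x → h x + τ ≤ g →
      (labelMeasure V ν).real (fireSet G (par x) x τ) = fireProb r p η τ) :
    Branches ν y (kids G par y) (below h par) (fireSet G y) (fireProb r p η) j := by
  have hkid : ∀ x ∈ kids G par y, h x = h y + 1 ∧ par x = y := fun x hx =>
    R.kid hy (mem_kids.1 hx)
  constructor
  · exact fun x hx τ hτ => R.dependsOn_fireSet (by lia) (mem_kids.1 hx)
  · exact fun x hx x' hx' hne => disjoint_below ((hkid x hx).1.trans (hkid x' hx').1.symm) hne
  · exact fun x hx => notMem_below (hkid x hx).1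
  · intro x hx τ hτ
    obtain ⟨hxy, hpar⟩ := hkid x hx
    have hx := hprob τ hτ x (by lia) (by lia)
    rwa [hpar] at hx
  · exact fun x _ τ τ' hne => Set.disjoint_left.2 fun ω hτ hτ' => hne (Fires.unique hτ hτ')

lemma fireSet_par_succ (y : V) (i : ℕ) : fireSet G (par y) y (i + 1) =
    triggerSet (fireSet G y) y (kids G par y) (i + 1) (i + 1) := by
  ext ω
  simp only [fireSet, triggerSet, silentSet, Set.mem_ofPred_eq, Set.mem_sdiff, Finset.mem_coe,
    Set.mem_singleton_iff, mem_kids]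
  rw [fires_iff]
  constructor
  · rintro (⟨hi, -⟩ | ⟨-, x, hadj, hne, τ, hτ, hfire, hsum, hothers⟩)
    · exact absurd hi i.succ_ne_zero
    · exact ⟨x, ⟨hadj, hne⟩, τ, hτ, hfire, hsum, fun x' hx' => hothers x' hx'.1.1 hx'.1.2 hx'.2⟩
  · rintro ⟨x, ⟨hadj, hne⟩, τ, hτ, hfire, hsum, hothers⟩
    exact Or.inr ⟨by lia, x, hadj, hne, τ, hτ, hfire, hsum,
      fun x' hadj' hne' hx' => hothers x' ⟨⟨hadj', hne'⟩, hx'⟩⟩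

lemma whiteChain_succ_subset {N k : ℕ} {y : V} : {ω | WhiteChain G ω N par (k + 1) y} ⊆
    ⋃ x ∈ kids G par y, {ω : V → ℕ | ω y ∈ ({0}ᶜ : Set ℕ)} ∩
      ({ω | WhiteChain G ω N par k x} ∩ silentSet (fireSet G y) (N + 1) (kids G par y \ {x})) := by
  rintro ω ⟨hnot, x, hx, hchain, hsilent⟩
  refine Set.mem_biUnion (mem_kids.2 hx) ⟨hnot, hchain, fun x' hx' τ hτ => ?_⟩
  exact hsilent x' (mem_kids.1 hx'.1) hx'.2 τ (Nat.le_of_lt_succ hτ)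

variable [IsProbabilityMeasure ν]

lemma prob_fireSet_par (R : Rooting G v g h par) (hdeg : ∀ y, (G.neighborSet y).ncard = r)
    (hν : ∀ k, ν.real {k} = labelProb p η k) (i : ℕ) : ∀ y, 0 < h y → h y + i ≤ g →
      (labelMeasure V ν).real (fireSet G (par y) y i) = fireProb r p η i := by
  induction i using Nat.strong_induction_on with
  | _ i ih =>
    intro y hy hyi
    rcases i with _ | i
    · have hseed : fireSet G (par y) y 0 = {ω | ω y ∈ ({0} : Set ℕ)} := by
        ext ω
        exact fires_zero_iff
      rw [hseed, measureReal_label, hν, labelProb, fireProb]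
    · have hB := R.branches_of_prob_fireSet (by lia) hyi ih
      have hcard := R.card_kids_add_one hdeg hy (by lia)
      have hcast : ((kids G par y).card : ℝ) = r - 1 := by
        rw [← hcard, Nat.cast_add_one, add_sub_cancel_right]
      rw [fireSet_par_succ, hB.prob_triggerSet le_rfl, fireProb_succ, silence_eq_one_sub_sum,
        hcast, show (kids G par y).card - 1 = r - 2 by lia]
      simp only [hν]

lemma branches (R : Rooting G v g h par) (hdeg : ∀ y, (G.neighborSet y).ncard = r)
    (hν : ∀ k, ν.real {k} = labelProb p η k) {y : V} {j : ℕ} (hy : h y < g) (hyj : h y + j ≤ g) :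
    Branches ν y (kids G par y) (below h par) (fireSet G y) (fireProb r p η) j :=
  R.branches_of_prob_fireSet hy hyj fun τ _ => R.prob_fireSet_par hdeg hν τ

lemma branches_root (R : Rooting G v g h par) (hdeg : ∀ y, (G.neighborSet y).ncard = r)
    (hν : ∀ k, ν.real {k} = labelProb p η k) {j : ℕ} (hj : 0 < j) (hjg : j ≤ g) :
    Branches ν v (kids G par v) (below h par) (fireSet G v) (fireProb r p η) j :=
  R.branches hdeg hν (by rw [R.root]; lia) (by rw [R.root]; lia)

lemma prob_whiteChain_le (R : Rooting G v g h par) (hdeg : ∀ y, (G.neighborSet y).ncard = r)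
    (hν : ∀ k, ν.real {k} = labelProb p η k) {N : ℕ} (hs : 0 ≤ silence r p η N) (k : ℕ) :
    ∀ y, 0 < h y → h y + k + (N + 1) ≤ g →
      (labelMeasure V ν).real {ω | WhiteChain G ω N par k y}
        ≤ branchRate r p (silence r p η N) ^ k := by
  induction k with
  | zero => intro y _ _; simp
  | succ k ih =>
    intro y hy hyk
    set a := silence r p η N with ha
    have hB := R.branches hdeg hν (y := y) (j := N + 1) (by lia) (by lia)
    have hcard := R.card_kids_add_one hdeg hy (by lia)
    have hcast : ((kids G par y).card : ℝ) = r - 1 := by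
      rw [← hcard, Nat.cast_add_one, add_sub_cancel_right]
    have hp : 0 ≤ 1 - p := prob_nonseed hν ▸ measureReal_nonneg
    have hkid : ∀ x ∈ kids G par y, (labelMeasure V ν).real
        ({ω : V → ℕ | ω y ∈ ({0}ᶜ : Set ℕ)} ∩ ({ω | WhiteChain G ω N par k x} ∩
          silentSet (fireSet G y) (N + 1) (kids G par y \ {x})))
        ≤ (1 - p) * branchRate r p a ^ k * a ^ (r - 2) := by
      intro x hx
      have hxy := (R.kid (by lia) (mem_kids.1 hx)).1
      rw [hB.prob_label_inter_inter_silentSet hx _ (R.dependsOn_whiteChain k x (by lia)),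
        prob_nonseed hν, ← silence_eq_one_sub_sum, ← ha,
        show (kids G par y).card - 1 = r - 2 by lia]
      gcongr
      exact ih x (by lia) (by lia)
    calc _ ≤ _ := measureReal_mono whiteChain_succ_subset (measure_ne_top _ _)
      _ ≤ _ := measureReal_biUnion_finset_le _ _
      _ ≤ _ := Finset.sum_le_card_nsmul _ _ _ hkid
      _ = branchRate r p a ^ (k + 1) := by
        rw [nsmul_eq_mul, hcast, pow_succ]
        simp only [branchRate]
        ring

variable {N : ℕ}

lemma prob_purpleAt_zero (R : Rooting G v g h par) (hdeg : ∀ y, (G.neighborSet y).ncard = r)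
    (hν : ∀ k, ν.real {k} = labelProb p η k) (hg : 1 ≤ g) :
    (labelMeasure V ν).real {ω | PurpleAt G ω 0 v} = p * (1 - p) ^ r := by
  have hB := R.branches_root hdeg hν (j := 1) (by lia) (by lia)
  have hevent : {ω : V → ℕ | PurpleAt G ω 0 v} =
      {ω | ω v ∈ ({0} : Set ℕ)} ∩ silentSet (fireSet G v) 1 (kids G par v) := by
    ext ω
    simp [PurpleAt, silentSet, fireSet, R.mem_kids_root, fires_zero_iff]
  rw [hevent, hB.prob_label_inter_silentSet, R.card_kids_root hdeg, hν]
  simp [labelProb, fireProb]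

lemma prob_purpleAt_succ (R : Rooting G v g h par) (hdeg : ∀ y, (G.neighborSet y).ncard = r)
    (hν : ∀ k, ν.real {k} = labelProb p η k) {i : ℕ} (hg : i + 2 ≤ g) :
    (labelMeasure V ν).real {ω | PurpleAt G ω (i + 1) v} = purpleDensity r p η i := by
  have hB := R.branches_root hdeg hν (j := i + 2) (by lia) (by lia)
  have hevent : {ω : V → ℕ | PurpleAt G ω (i + 1) v} =
      triggerSet (fireSet G v) v (kids G par v) (i + 1) (i + 2) := by
    ext ω
    simp only [PurpleAt, triggerSet, silentSet, fireSet, Set.mem_ofPred_eq, Set.mem_sdiff,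
      Finset.mem_coe, Set.mem_singleton_iff, R.mem_kids_root, Nat.lt_succ_iff (n := i + 1)]
    constructor
    · rintro (⟨hi, -⟩ | ⟨-, x, hadj, τ, hτ, hfire, hsum, hothers⟩)
      · exact absurd hi i.succ_ne_zero
      · exact ⟨x, hadj, τ, hτ, hfire, hsum, fun x' hx' => hothers x' hx'.1 hx'.2⟩
    · rintro ⟨x, hadj, τ, hτ, hfire, hsum, hothers⟩
      exact Or.inr ⟨by lia, x, hadj, τ, hτ, hfire, hsum, fun x' hx hne => hothers x' ⟨hx, hne⟩⟩
  rw [hevent, hB.prob_triggerSet (by lia), R.card_kids_root hdeg, purpleDensity, pressure_eq_sum,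
    silence_eq_one_sub_sum]
  simp only [hν]

lemma prob_white (R : Rooting G v g h par) (hdeg : ∀ y, (G.neighborSet y).ncard = r)
    (hν : ∀ k, ν.real {k} = labelProb p η k) (hg : N + 1 ≤ g) :
    (labelMeasure V ν).real {ω | White G ω N v} = (1 - p) * silence r p η N ^ r := by
  have hB := R.branches_root hdeg hν (j := N + 1) (by lia) (by lia)
  have hevent : {ω : V → ℕ | White G ω N v} =
      {ω | ω v ∈ ({0}ᶜ : Set ℕ)} ∩ silentSet (fireSet G v) (N + 1) (kids G par v) := by
    ext ω
    simp [White, silentSet, fireSet, R.mem_kids_root]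
  rw [hevent, hB.prob_label_inter_silentSet, R.card_kids_root hdeg, prob_nonseed hν,
    silence_eq_one_sub_sum]

lemma prob_purple_or_white (R : Rooting G v g h par) (hdeg : ∀ y, (G.neighborSet y).ncard = r)
    (hν : ∀ k, ν.real {k} = labelProb p η k) (hg : N + 1 ≤ g) :
    (labelMeasure V ν).real
      ((⋃ i ∈ Finset.range (N + 1), {ω | PurpleAt G ω i v}) ∪ {ω | White G ω N v}) =
      processDensity r p η N := by
  have hpurple : (Finset.range (N + 1) : Set ℕ).PairwiseDisjoint
      fun i => {ω : V → ℕ | PurpleAt G ω i v} :=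
    fun i _ j _ hij => Set.disjoint_left.2 fun ω hi hj => hij (PurpleAt.unique hi hj)
  have hwhite : Disjoint (⋃ i ∈ Finset.range (N + 1), {ω : V → ℕ | PurpleAt G ω i v})
      {ω | White G ω N v} := by
    rw [Set.disjoint_left]
    intro ω hω hw
    obtain ⟨i, hi, hpurple⟩ := Set.mem_iUnion₂.1 hω
    exact White.not_purple hw (Finset.mem_range_succ_iff.1 hi) hpurple
  rw [measureReal_union hwhite .of_discrete (measure_ne_top _ _) (measure_ne_top _ _),
    measureReal_biUnion_finset hpurple fun _ _ => .of_discrete,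
    Finset.sum_range_succ', R.prob_purpleAt_zero hdeg hν (by lia), R.prob_white hdeg hν hg,
    Finset.sum_congr rfl fun i hi => R.prob_purpleAt_succ hdeg hν
      (by have := Finset.mem_range.1 hi; lia), processDensity]
  ring

lemma prob_exists_whiteChain_le (R : Rooting G v g h par)
    (hdeg : ∀ y, (G.neighborSet y).ncard = r) (hν : ∀ k, ν.real {k} = labelProb p η k) {l : ℕ}
    (hs : 0 ≤ silence r p η N) (hg : N + l + 2 ≤ g) :
    (labelMeasure V ν).real (⋃ x ∈ kids G par v, {ω | WhiteChain G ω N par l x}) ≤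
      r * branchRate r p (silence r p η N) ^ l := by
  refine (measureReal_biUnion_finset_le _ _).trans ?_
  refine (Finset.sum_le_card_nsmul _ _ _ fun x hx => ?_).trans_eq
    (by rw [R.card_kids_root hdeg, nsmul_eq_mul])
  have hroot := R.root
  have hx := (R.kid (by lia) (mem_kids.1 hx)).1
  exact R.prob_whiteChain_le hdeg hν hs l x (by lia) (by lia)

lemma purple_or_white_subset (R : Rooting G v g h par) {l : ℕ} (hg : l + 1 ≤ g) :
    (⋃ i ∈ Finset.range (N + 1), {ω | PurpleAt G ω i v}) ∪ {ω | White G ω N v} ⊆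
      {ω | v ∈ grownForest G ω N} ∪ ⋃ x ∈ kids G par v, {ω | WhiteChain G ω N par l x} := by
  rintro ω (hω | hwhite)
  · obtain ⟨i, hi, hpurple⟩ := Set.mem_iUnion₂.1 hω
    exact Or.inl (Or.inl ⟨i, Finset.mem_range_succ_iff.1 hi, hpurple⟩)
  · by_cases hleaf : ∀ T : Finset V, v ∈ T → (∀ x ∈ T, White G ω N x) → HasLeaf G T
    · exact Or.inl (Or.inr ⟨hwhite, hleaf⟩)
    · push Not at hleaf
      obtain ⟨T, hvT, hT, hnoleaf⟩ := hleaf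
      obtain ⟨-, x, hx, hchain, -⟩ :=
        R.whiteChain_of_not_hasLeaf hT hnoleaf (l + 1) v hvT (by rw [R.root]; lia)
      exact Or.inr (Set.mem_biUnion (mem_kids.2 hx) hchain)

theorem prob_grownForest_ge (R : Rooting G v g h par) (hdeg : ∀ y, (G.neighborSet y).ncard = r)
    (hν : ∀ k, ν.real {k} = labelProb p η k) {l : ℕ} (hs : 0 ≤ silence r p η N)
    (hg : N + l + 2 ≤ g) :
    processDensity r p η N - r * branchRate r p (silence r p η N) ^ l ≤
      (labelMeasure V ν).real {ω | v ∈ grownForest G ω N} := by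
  rw [sub_le_iff_le_add]
  calc processDensity r p η N
      = (labelMeasure V ν).real _ := (R.prob_purple_or_white hdeg hν (by lia)).symm
    _ ≤ (labelMeasure V ν).real _ :=
        measureReal_mono (R.purple_or_white_subset (l := l) (by lia)) (measure_ne_top _ _)
    _ ≤ _ := measureReal_union_le _ _
    _ ≤ _ := by gcongr; exact R.prob_exists_whiteChain_le hdeg hν hs hg

end Rooting

end

section

variable {V : Type*} {G : SimpleGraph V} {v : V} {g : ℕ} {h : V → ℕ} {par : V → V}

/-- `S` spans at least as many edges of `G` as it has vertices. -/
def IsDense (G : SimpleGraph V) (S : Finset V) : Prop :=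
  ∃ E : Finset (Sym2 V), E.card = S.card ∧ ∀ e ∈ E, e ∈ G.edgeSet ∧ ∀ x ∈ e, x ∈ S

/-- The vertices in a dense set with at most `k` elements. In a graph of girth more than `k` there
are none. -/
def badVertices (G : SimpleGraph V) (k : ℕ) : Set V :=
  {v | ∃ S : Finset V, v ∈ S ∧ S.card ≤ k ∧ IsDense G S}

/-- `S` is the vertex set of a subtree with root `v`, in which `par u` is the parent of `u` and the
heights `h` certify that there is no cycle. -/
def IsSubtree (G : SimpleGraph V) (v : V) (h : V → ℕ) (par : V → V) (S : Finset V) : Prop :=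
  v ∈ S ∧ ∀ u ∈ S, u ≠ v → par u ∈ S ∧ G.Adj u (par u) ∧ h (par u) < h u

open Classical in
lemma IsSubtree.union {S T : Finset V} (hS : IsSubtree G v h par S) (hT : IsSubtree G v h par T) :
    IsSubtree G v h par (S ∪ T) := by
  refine ⟨Finset.mem_union_left _ hS.1, fun u hu hne => ?_⟩
  rcases Finset.mem_union.1 hu with hu | hu
  · exact (hS.2 u hu hne).imp_left (Finset.mem_union_left _)
  · exact (hT.2 u hu hne).imp_left (Finset.mem_union_right _)

lemma IsSubtree.isDense {S : Finset V} (hS : IsSubtree G v h par S) {z w : V} (hz : z ∈ S)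
    (hw : w ∈ S) (hzw : G.Adj z w) (hzpar : par z ≠ w) (hwpar : par w ≠ z) : IsDense G S := by
  classical
  have hmem : ∀ u ∈ S.erase v, u ∈ S ∧ par u ∈ S ∧ G.Adj u (par u) ∧ h (par u) < h u := fun u hu =>
    ⟨Finset.mem_of_mem_erase hu, hS.2 u (Finset.mem_of_mem_erase hu) (Finset.ne_of_mem_erase hu)⟩
  have hinj : Set.InjOn (fun u => s(u, par u)) (S.erase v) := by
    intro u hu u' hu' he
    rcases Sym2.eq_iff.1 he with ⟨heq, -⟩ | ⟨heq, hpar⟩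
    · exact heq
    · have hlt := (hmem u hu).2.2.2
      have hlt' := (hmem u' hu').2.2.2
      rw [← heq] at hlt'
      rw [hpar] at hlt
      exact absurd hlt hlt'.asymm
  have hnew : s(z, w) ∉ (S.erase v).image fun u => s(u, par u) := by
    intro he
    obtain ⟨u, -, he⟩ := Finset.mem_image.1 he
    rcases Sym2.eq_iff.1 he with ⟨rfl, hpar⟩ | ⟨rfl, hpar⟩
    · exact hzpar hpar
    · exact hwpar hpar
  refine ⟨insert s(z, w) ((S.erase v).image fun u => s(u, par u)), ?_, ?_⟩
  · rw [Finset.card_insert_of_notMem hnew, Finset.card_image_of_injOn hinj,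
      Finset.card_erase_add_one hS.1]
  · simp only [Finset.forall_mem_insert, Finset.forall_mem_image, SimpleGraph.mem_edgeSet,
      Sym2.ball]
    exact ⟨⟨hzw, hz, hw⟩, fun u hu => ⟨(hmem u hu).2.2.1, (hmem u hu).1, (hmem u hu).2.1⟩⟩

lemma exists_isSubtree
    (hpar : ∀ z, h z ≤ g → z ≠ v → G.Adj z (par z) ∧ h (par z) + 1 = h z) (m : ℕ) :
    ∀ z, h z = m → m ≤ g → ∃ S : Finset V, IsSubtree G v h par S ∧ z ∈ S ∧ S.card ≤ m + 1 := by
  classical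
  induction m with
  | zero =>
    intro z hz _
    have hzv : z = v := by
      by_contra hne
      have := (hpar z (by lia) hne).2
      lia
    exact ⟨{v}, by simp [IsSubtree], by simp [hzv], by simp⟩
  | succ m ih =>
    intro z hz hm
    by_cases hzv : z = v
    · exact ⟨{v}, by simp [IsSubtree], by simp [hzv], by simp⟩
    obtain ⟨hadj, hheight⟩ := hpar z (by lia) hzv
    obtain ⟨S, hS, hparS, hcard⟩ := ih (par z) (by lia) (by lia)
    refine ⟨insert z S, ⟨Finset.mem_insert_of_mem hS.1, fun u hu hne => ?_⟩,
      Finset.mem_insert_self z S, (Finset.card_insert_le z S).trans (by lia)⟩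
    rcases Finset.mem_insert.1 hu with rfl | hu
    · exact ⟨Finset.mem_insert_of_mem hparS, hadj, by lia⟩
    · exact (hS.2 u hu hne).imp_left Finset.mem_insert_of_mem

lemma exists_adj_dist_add_one {z : V} (hz : G.Reachable v z) (hne : z ≠ v) :
    ∃ w, G.Adj z w ∧ G.dist v w + 1 = G.dist v z := by
  obtain ⟨q, hq⟩ := hz.symm.exists_walk_length_eq_dist
  cases q with
  | nil => exact absurd rfl hne
  | @cons _ w _ hadj q =>
    have hadj : G.Adj w z := hadj.symm
    refine ⟨w, hadj.symm, ?_⟩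
    have hshort := SimpleGraph.dist_le q
    have hlong := hadj.reachable.dist_triangle_right v
    rw [SimpleGraph.dist_eq_one_iff_adj.2 hadj] at hlong
    rw [SimpleGraph.Walk.length_cons, G.dist_comm] at hq
    rw [G.dist_comm] at hshort
    lia

lemma exists_parents (G : SimpleGraph V) (v : V) (g : ℕ) : ∃ (h : V → ℕ) (par : V → V),
    h v = 0 ∧ par v = v ∧ (∀ z, h z ≤ g → z ≠ v → G.Adj z (par z) ∧ h (par z) + 1 = h z) ∧
      ∀ z w, h z ≤ g → G.Adj z w → h w ≤ h z + 1 := by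
  classical
  let h : V → ℕ := fun z => if G.Reachable v z then G.dist v z else g + 1
  have hdist : ∀ z, G.Reachable v z → h z = G.dist v z := fun z hz => if_pos hz
  have hreach : ∀ z, h z ≤ g → G.Reachable v z := fun z hz => by
    by_contra hno
    simp only [h, if_neg hno] at hz
    lia
  have hpar : ∀ z, ∃ w, (z = v → w = v) ∧
      (h z ≤ g → z ≠ v → G.Adj z w ∧ h w + 1 = h z) := by
    intro z
    by_cases hz : h z ≤ g ∧ z ≠ v
    · have hvz := hreach z hz.1
      obtain ⟨w, hzw, hw⟩ := exists_adj_dist_add_one hvz hz.2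
      refine ⟨w, fun hzv => absurd hzv hz.2, fun _ _ => ⟨hzw, ?_⟩⟩
      rw [hdist z hvz, hdist w (hvz.trans hzw.reachable), hw]
    · exact ⟨v, fun _ => rfl, fun hzg hne => absurd ⟨hzg, hne⟩ hz⟩
  choose par hroot hpar using hpar
  refine ⟨h, par, (hdist v .rfl).trans G.dist_self, hroot v rfl, hpar, fun z w hz hzw => ?_⟩
  have hvz := hreach z hz
  rw [hdist z hvz, hdist w (hvz.trans hzw.reachable), ← SimpleGraph.dist_eq_one_iff_adj.2 hzw]
  exact hzw.reachable.dist_triangle_right v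

theorem exists_rooting (hv : v ∉ badVertices G (2 * (g + 1))) : ∃ h par, Rooting G v g h par := by
  classical
  obtain ⟨h, par, hroot, hpar_root, hpar, hadj⟩ := exists_parents G v g
  have hne_root : ∀ z, 0 < h z → z ≠ v := by
    rintro z hz rfl
    lia
  refine ⟨h, par, hroot, hpar_root, fun z w hz hzw => ?_, fun z hz hzg =>
    (hpar z hzg (hne_root z hz)).1⟩
  have hw : h w ≤ g := (hadj z w hz.le hzw).trans hz
  have hparent : par w = z ∨ par z = w := by
    by_contra! hno
    obtain ⟨S, hS, hzS, hScard⟩ := exists_isSubtree hpar (h z) z rfl hz.le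
    obtain ⟨T, hT, hwT, hTcard⟩ := exists_isSubtree hpar (h w) w rfl hw
    exact hv ⟨S ∪ T, (hS.union hT).1, (Finset.card_union_le S T).trans (by lia),
      (hS.union hT).isDense (Finset.mem_union_left _ hzS) (Finset.mem_union_right _ hwT) hzw
        hno.2 hno.1⟩
  rcases hparent with hwz | hzw'
  · have hheight := (hpar w hw (by rintro rfl; exact hzw.ne (hwz.symm.trans hpar_root))).2
    rw [hwz] at hheight
    exact Or.inl ⟨hheight.symm, hwz⟩
  · have hheight := (hpar z hz.le (by rintro rfl; exact hzw.ne (hpar_root.symm.trans hzw'))).2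
    rw [hzw'] at hheight
    exact Or.inr ⟨hheight.symm, hzw'⟩

end

lemma exists_isProbabilityMeasure_labelProb {p η : ℝ} (hp0 : 0 ≤ p) (hp : p ≤ 1) (hη : 0 < η)
    (hη1 : η ≤ 1) :
    ∃ ν : Measure ℕ, IsProbabilityMeasure ν ∧ ∀ k, ν.real {k} = labelProb p η k := by
  have hnonneg : ∀ k, 0 ≤ labelProb p η k
    | 0 => hp0
    | k + 1 => mul_nonneg (mul_nonneg (sub_nonneg.2 hp) hη.le) (pow_nonneg (sub_nonneg.2 hη1) k)
  have hsum : HasSum (labelProb p η) 1 := by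
    rw [← hasSum_nat_add_iff' 1]
    have hgeom := (hasSum_geometric_of_lt_one (sub_nonneg.2 hη1) (sub_lt_self 1 hη)).mul_left
      ((1 - p) * η)
    rw [sub_sub_cancel, mul_assoc, mul_inv_cancel₀ hη.ne', mul_one] at hgeom
    simpa [labelProb] using hgeom
  have hsum' : HasSum (fun k => ENNReal.ofReal (labelProb p η k)) 1 := by
    rw [← ENNReal.ofReal_one, ← hsum.tsum_eq,
      ENNReal.ofReal_tsum_of_nonneg hnonneg hsum.summable]
    exact ENNReal.summable.hasSum
  let law : PMF ℕ := ⟨fun k => ENNReal.ofReal (labelProb p η k), hsum'⟩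
  refine ⟨law.toMeasure, inferInstance, fun k => ?_⟩
  rw [Measure.real, law.toMeasure_apply_singleton k (MeasurableSet.singleton k)]
  exact ENNReal.toReal_ofReal (hnonneg k)

lemma exists_sum_measureReal_le_ncard {V Ω : Type*} [Fintype V] [MeasurableSpace Ω]
    (μ : Measure Ω) [IsProbabilityMeasure μ] {A : Ω → Set V}
    (hA : ∀ v, MeasurableSet {ω | v ∈ A ω}) :
    ∃ ω, ∑ v, μ.real {ω | v ∈ A ω} ≤ ((A ω).ncard : ℝ) := by
  classical
  have hint : ∀ v, Integrable ({ω | v ∈ A ω}.indicator (1 : Ω → ℝ)) μ := fun v =>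
    (integrable_const (1 : ℝ)).indicator (hA v)
  obtain ⟨ω, hω⟩ := exists_integral_le (integrable_finsetSum Finset.univ fun v _ => hint v)
  refine ⟨ω, ?_⟩
  calc ∑ v, μ.real {ω | v ∈ A ω}
      = ∫ ω, ∑ v, {ω | v ∈ A ω}.indicator (1 : Ω → ℝ) ω ∂μ := by
        rw [integral_finsetSum _ fun v _ => hint v]
        exact Finset.sum_congr rfl fun v _ => (integral_indicator_one (hA v)).symm
    _ ≤ ∑ v, {ω | v ∈ A ω}.indicator (1 : Ω → ℝ) ω := by simpa using hω
    _ = ((A ω).ncard : ℝ) := by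
        rw [Set.ncard_eq_toFinset_card']
        simp [Set.indicator_apply]

theorem exists_large_forest {r : ℕ} {p α : ℝ} (hα : IsStop r p α) (hr : 3 ≤ r) (hp0 : 0 < p)
    (hp : p < 1) {ε : ℝ} (hε : 0 < ε) : ∃ k : ℕ, ∀ (n : ℕ) (G : SimpleGraph (Fin n)),
      (∀ y, (G.neighborSet y).ncard = r) → ((badVertices G k).ncard : ℝ) ≤ ε * n →
      HasInducedForest G ((forestDensity r p α - 5 * ε) * n) := by
  classical
  have hr0 : (0 : ℝ) < r := by exact_mod_cast (by lia : 0 < r)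
  obtain ⟨η, N, hη, hrate, hdensity⟩ := exists_processDensity_ge hα hr hp0 hp hε
  have hs := hη.silence_pos N
  obtain ⟨ν, _, hν⟩ := exists_isProbabilityMeasure_labelProb hp0.le hp.le hη.pos hη.lt_one.le
  obtain ⟨l, hl⟩ := exists_pow_lt_of_lt_one (div_pos hε hr0) hrate
  rw [lt_div_iff₀' hr0] at hl
  refine ⟨2 * (N + l + 2 + 1), fun n G hdeg hbad => ?_⟩
  set B := badVertices G (2 * (N + l + 2 + 1))
  have hprob : ∀ v, forestDensity r p α - 2 * ε - (if v ∈ B then 3 else 0) ≤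
      (labelMeasure (Fin n) ν).real {ω | v ∈ grownForest G ω N} := by
    intro v
    split_ifs with hv
    · have hthree : forestDensity r p α ≤ 3 := forestDensity_le_three (by lia) hp0.le hp.le
        hα.pos.le (by linarith [hα.lt_one_sub])
      exact le_trans (by linarith) measureReal_nonneg
    · obtain ⟨h, par, R⟩ := exists_rooting hv
      linarith [R.prob_grownForest_ge hdeg hν (l := l) hs.le le_rfl]
  obtain ⟨ω, hω⟩ := exists_sum_measureReal_le_ncard (labelMeasure (Fin n) ν)
    (A := fun ω => grownForest G ω N) fun _ => .of_discrete
  refine ⟨(grownForest G ω N).toFinset, ?_, ?_⟩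
  · rw [Set.coe_toFinset]
    exact isAcyclic_grownForest
  rw [← Set.ncard_eq_toFinset_card']
  calc (forestDensity r p α - 5 * ε) * n
      ≤ (forestDensity r p α - 2 * ε) * n - 3 * B.ncard := by linarith
    _ = ∑ v, (forestDensity r p α - 2 * ε - (if v ∈ B then 3 else 0)) := by
        simp [Finset.sum_sub_distrib, Finset.sum_ite, Set.ncard_eq_toFinset_card']
        ring
    _ ≤ ∑ v, (labelMeasure (Fin n) ν).real {ω | v ∈ grownForest G ω N} :=
        Finset.sum_le_sum fun v _ => hprob v
    _ ≤ _ := hω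

section

variable {V : Type*}

/-- The graph obtained from `G` by replacing the edges `uv`, `xy` with `ux`, `vy`. -/
def switchGraph (G : SimpleGraph V) (u v x y : V) : SimpleGraph V :=
  SimpleGraph.fromEdgeSet ((G.edgeSet \ {s(u, v), s(x, y)}) ∪ {s(u, x), s(v, y)})

/-- The conditions under which `uv`, `xy` can be switched to `ux`, `vy`. -/
structure Switchable (G : SimpleGraph V) (u v x y : V) : Prop where
  adj_uv : G.Adj u v
  adj_xy : G.Adj x y
  ne_xu : x ≠ u
  ne_yv : y ≠ v
  not_adj_ux : ¬ G.Adj u x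
  not_adj_vy : ¬ G.Adj v y

variable {G G' : SimpleGraph V} {u v x y : V} {r : ℕ}

lemma switchGraph_reverse (G : SimpleGraph V) (u v x y : V) :
    switchGraph G v u y x = switchGraph G u v x y := by
  rw [switchGraph, switchGraph, Sym2.eq_swap, Sym2.eq_swap (a := y), Set.pair_comm s(v, y)]

lemma switchGraph_exchange (G : SimpleGraph V) (u v x y : V) :
    switchGraph G x y u v = switchGraph G u v x y := by
  rw [switchGraph, switchGraph, Set.pair_comm s(x, y), Sym2.eq_swap (a := x) (b := u),
    Sym2.eq_swap (a := y) (b := v)]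

namespace Switchable

lemma reverse (h : Switchable G u v x y) : Switchable G v u y x :=
  ⟨h.adj_uv.symm, h.adj_xy.symm, h.ne_yv, h.ne_xu, h.not_adj_vy, h.not_adj_ux⟩

lemma exchange (h : Switchable G u v x y) : Switchable G x y u v :=
  ⟨h.adj_xy, h.adj_uv, h.ne_xu.symm, h.ne_yv.symm, fun hxu => h.not_adj_ux hxu.symm,
    fun hyv => h.not_adj_vy hyv.symm⟩

lemma edgeSet_switchGraph (h : Switchable G u v x y) :
    (switchGraph G u v x y).edgeSet = (G.edgeSet \ {s(u, v), s(x, y)}) ∪ {s(u, x), s(v, y)} := by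
  rw [switchGraph, SimpleGraph.edgeSet_fromEdgeSet, sdiff_eq_left, Set.disjoint_left]
  rintro e (he | rfl | rfl) hdiag
  · exact G.not_isDiag_of_mem_edgeSet he.1 hdiag
  · exact h.ne_xu (Sym2.mk_isDiag_iff.1 hdiag).symm
  · exact h.ne_yv (Sym2.mk_isDiag_iff.1 hdiag).symm

lemma adj_switchGraph (h : Switchable G u v x y) (a b : V) :
    (switchGraph G u v x y).Adj a b ↔
      (G.Adj a b ∧ s(a, b) ≠ s(u, v) ∧ s(a, b) ≠ s(x, y)) ∨ s(a, b) = s(u, x) ∨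
        s(a, b) = s(v, y) := by
  rw [← SimpleGraph.mem_edgeSet, h.edgeSet_switchGraph]
  simp only [Set.mem_union, Set.mem_sdiff, Set.mem_insert_iff, Set.mem_singleton_iff, not_or,
    SimpleGraph.mem_edgeSet]

lemma edgeSet_eq (h : Switchable G u v x y) :
    G.edgeSet = ((switchGraph G u v x y).edgeSet \ {s(u, x), s(v, y)}) ∪ {s(u, v), s(x, y)} := by
  have hold : ({s(u, v), s(x, y)} : Set (Sym2 V)) ⊆ G.edgeSet := Set.pair_subset h.adj_uv h.adj_xy
  have hnew : Disjoint G.edgeSet {s(u, x), s(v, y)} :=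
    Set.disjoint_insert_right.2 ⟨h.not_adj_ux, Set.disjoint_singleton_right.2 h.not_adj_vy⟩
  rw [h.edgeSet_switchGraph, Set.union_sdiff_cancel_right, Set.sdiff_union_of_subset hold]
  exact (hnew.mono_left Set.sdiff_subset).le_bot

lemma eq_of_switchGraph_eq (h : Switchable G u v x y) (h' : Switchable G' u v x y)
    (heq : switchGraph G u v x y = switchGraph G' u v x y) : G = G' := by
  rw [← SimpleGraph.edgeSet_inj, h.edgeSet_eq, h'.edgeSet_eq, heq]

lemma neighborSet_switchGraph (h : Switchable G u v x y) :
    (switchGraph G u v x y).neighborSet u = insert x (G.neighborSet u \ {v}) := by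
  have hux := h.ne_xu
  have huv := h.adj_uv.ne
  have hyu : y ≠ u := by
    rintro rfl
    exact h.not_adj_vy h.adj_uv.symm
  ext b
  simp only [SimpleGraph.mem_neighborSet, h.adj_switchGraph, Set.mem_insert_iff, Set.mem_sdiff,
    Set.mem_singleton_iff, ne_eq, Sym2.eq_iff]
  grind

lemma ncard_neighborSet_eq (h : Switchable G u v x y) :
    ((switchGraph G u v x y).neighborSet u).ncard = (G.neighborSet u).ncard := by
  rw [h.neighborSet_switchGraph]
  exact Set.ncard_exchange (s := G.neighborSet u) h.not_adj_ux h.adj_uv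

lemma ncard_neighborSet (h : Switchable G u v x y) (a : V) :
    ((switchGraph G u v x y).neighborSet a).ncard = (G.neighborSet a).ncard := by
  by_cases ha : a = u ∨ a = v ∨ a = x ∨ a = y
  · rcases ha with rfl | rfl | rfl | rfl
    · exact h.ncard_neighborSet_eq
    · exact switchGraph_reverse G u a x y ▸ h.reverse.ncard_neighborSet_eq
    · exact switchGraph_exchange G u v a y ▸ h.exchange.ncard_neighborSet_eq
    · rw [← switchGraph_exchange, ← switchGraph_reverse]
      exact h.exchange.reverse.ncard_neighborSet_eq
  · congr 1
    ext b
    simp only [SimpleGraph.mem_neighborSet, h.adj_switchGraph, ne_eq, Sym2.eq_iff]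
    grind

end Switchable

variable [Fintype V]

open Classical in
/-- The `r`-regular graphs that contain all edges in `H`. -/
def regularWith (V : Type*) [Fintype V] (r : ℕ) (H : Finset (Sym2 V)) :
    Finset (SimpleGraph V) :=
  Finset.univ.filter fun G => (∀ a, (G.neighborSet a).ncard = r) ∧ ∀ e ∈ H, e ∈ G.edgeSet

lemma mem_regularWith {H : Finset (Sym2 V)} : G ∈ regularWith V r H ↔
    (∀ a, (G.neighborSet a).ncard = r) ∧ ∀ e ∈ H, e ∈ G.edgeSet := by
  simp [regularWith]

lemma Switchable.switchGraph_mem_regularWith {S : Finset V} {H : Finset (Sym2 V)}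
    (h : Switchable G u v x y) (hH : ∀ e ∈ H, ∀ x ∈ e, x ∈ S) (huv : s(u, v) ∉ H) (hx : x ∉ S)
    (hG : G ∈ regularWith V r H) : switchGraph G u v x y ∈ regularWith V r H := by
  obtain ⟨hdeg, hedges⟩ := mem_regularWith.1 hG
  refine mem_regularWith.2 ⟨fun a => (h.ncard_neighborSet a).trans (hdeg a), fun e he => ?_⟩
  rw [h.edgeSet_switchGraph]
  refine Or.inl ⟨hedges e he, ?_⟩
  rintro (rfl | rfl)
  exacts [huv he, hx (hH _ he _ (Sym2.mem_mk_left _ _))]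

open Classical in
lemma card_neighborFinset (hdeg : ∀ a, (G.neighborSet a).ncard = r) (a : V) :
    (G.neighborFinset a).card = r := by
  rw [← hdeg a, ← Set.ncard_coe_finset, SimpleGraph.coe_neighborFinset]

open Classical in
lemma card_adj_fst_mem (hdeg : ∀ a, (G.neighborSet a).ncard = r) (A : Finset V) :
    (Finset.univ.filter fun q : V × V => G.Adj q.1 q.2 ∧ q.1 ∈ A).card = r * A.card := by
  have hsigma : (Finset.univ.filter fun q : V × V => G.Adj q.1 q.2 ∧ q.1 ∈ A).card =
      (A.sigma fun a => G.neighborFinset a).card :=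
    Finset.card_equiv (Equiv.sigmaEquivProd V V).symm fun q => by simp [and_comm]
  rw [hsigma, Finset.card_sigma, Finset.sum_congr rfl fun a _ => card_neighborFinset hdeg a,
    Finset.sum_const, smul_eq_mul, mul_comm]

open Classical in
lemma card_adj_snd_mem (hdeg : ∀ a, (G.neighborSet a).ncard = r) (A : Finset V) :
    (Finset.univ.filter fun q : V × V => G.Adj q.1 q.2 ∧ q.2 ∈ A).card = r * A.card := by
  rw [← card_adj_fst_mem hdeg A]
  exact Finset.card_equiv (Equiv.prodComm V V) fun q => by simp [G.adj_comm]

open Classical in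
/-- The ordered edges `xy` with `x ∉ S` with which `uv` can be switched. -/
def switches (G : SimpleGraph V) (u v : V) (S : Finset V) : Finset (V × V) :=
  Finset.univ.filter fun q => Switchable G u v q.1 q.2 ∧ q.1 ∉ S

lemma mem_switches {S : Finset V} {q : V × V} :
    q ∈ switches G u v S ↔ Switchable G u v q.1 q.2 ∧ q.1 ∉ S := by
  simp [switches]

lemma card_switches_ge (hdeg : ∀ a, (G.neighborSet a).ncard = r) (huv : G.Adj u v)
    (S : Finset V) :
    r * Fintype.card V - r * (S.card + 2 * r + 2) ≤ (switches G u v S).card := by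
  classical
  set A := S ∪ insert u (G.neighborFinset u) with hA
  set B := insert v (G.neighborFinset v) with hB
  have hclosed : ∀ a, (insert a (G.neighborFinset a)).card ≤ r + 1 := fun a =>
    (Finset.card_insert_le _ _).trans_eq (by rw [card_neighborFinset hdeg])
  have hcover : (Finset.univ.filter fun q : V × V => G.Adj q.1 q.2 ∧ q.1 ∈ Finset.univ) ⊆
      switches G u v S ∪ ((Finset.univ.filter fun q => G.Adj q.1 q.2 ∧ q.1 ∈ A) ∪
        Finset.univ.filter fun q => G.Adj q.1 q.2 ∧ q.2 ∈ B) := by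
    intro q hq
    by_contra hno
    simp only [hA, hB, mem_switches, Finset.mem_union, Finset.mem_filter, Finset.mem_univ,
      Finset.mem_insert, SimpleGraph.mem_neighborFinset, true_and, and_true] at hq hno
    push Not at hno
    obtain ⟨hswitch, hfst, hsnd⟩ := hno
    have hfst := hfst hq
    have hsnd := hsnd hq
    exact hfst.1 (hswitch ⟨huv, hq, hfst.2.1, hsnd.1, hfst.2.2, hsnd.2⟩)
  have hcount := (Finset.card_le_card hcover).trans ((Finset.card_union_le _ _).trans
    (Nat.add_le_add_left (Finset.card_union_le _ _) _))
  rw [card_adj_fst_mem hdeg, card_adj_fst_mem hdeg, card_adj_snd_mem hdeg, Finset.card_univ]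
    at hcount
  rw [tsub_le_iff_right]
  calc r * Fintype.card V ≤ (switches G u v S).card + (r * A.card + r * B.card) := hcount
    _ ≤ (switches G u v S).card + (r * (S.card + (r + 1)) + r * (r + 1)) := by
        gcongr
        · exact (Finset.card_union_le _ _).trans (Nat.add_le_add_left (hclosed u) _)
        · exact hclosed v
    _ = _ := by ring

-- Switching `uv` away maps the left side injectively into the graphs containing `H`, together with
-- a neighbour of `u` and a neighbour of `v`.
open Classical in
lemma sum_card_switches_le {S : Finset V} {H : Finset (Sym2 V)} (hH : ∀ e ∈ H, ∀ x ∈ e, x ∈ S)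
    (huv : s(u, v) ∉ H) :
    ∑ G ∈ regularWith V r (insert s(u, v) H), (switches G u v S).card ≤
      (regularWith V r H).card * r ^ 2 := by
  set target := (regularWith V r H).sigma fun G => G.neighborFinset u ×ˢ G.neighborFinset v
  have htarget : target.card = (regularWith V r H).card * r ^ 2 := by
    rw [Finset.card_sigma, Finset.sum_congr rfl fun G hG => by
      rw [Finset.card_product, card_neighborFinset (mem_regularWith.1 hG).1,
        card_neighborFinset (mem_regularWith.1 hG).1], Finset.sum_const, smul_eq_mul, sq]
  rw [← Finset.card_sigma, ← htarget]
  refine Finset.card_le_card_of_injOn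
    (fun z => ⟨switchGraph z.1 u v z.2.1 z.2.2, z.2⟩) ?_ ?_
  · rintro ⟨G, x, y⟩ hz
    obtain ⟨hG, hq⟩ := Finset.mem_sigma.1 hz
    obtain ⟨hswitch, hx⟩ := mem_switches.1 hq
    obtain ⟨hdeg, hedges⟩ := mem_regularWith.1 hG
    have hGH : G ∈ regularWith V r H :=
      mem_regularWith.2 ⟨hdeg, fun e he => hedges e (Finset.mem_insert_of_mem he)⟩
    refine Finset.mem_sigma.2
      ⟨hswitch.switchGraph_mem_regularWith hH huv hx hGH, Finset.mem_product.2 ⟨?_, ?_⟩⟩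
    · exact (SimpleGraph.mem_neighborFinset ..).2
        ((hswitch.adj_switchGraph _ _).2 (Or.inr (Or.inl rfl)))
    · exact (SimpleGraph.mem_neighborFinset ..).2
        ((hswitch.adj_switchGraph _ _).2 (Or.inr (Or.inr rfl)))
  · rintro ⟨G, q⟩ hz ⟨G', q'⟩ hz' heq
    simp only [Sigma.mk.injEq, heq_eq_eq] at heq
    obtain ⟨heq, rfl⟩ := heq
    have hswitch : Switchable G u v q.1 q.2 := (mem_switches.1 (Finset.mem_sigma.1 hz).2).1
    have hswitch' : Switchable G' u v q.1 q.2 := (mem_switches.1 (Finset.mem_sigma.1 hz').2).1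
    rw [hswitch.eq_of_switchGraph_eq hswitch' heq]

open Classical in
lemma card_regularWith_insert {S : Finset V} {H : Finset (Sym2 V)}
    (hH : ∀ e ∈ H, ∀ x ∈ e, x ∈ S) {e : Sym2 V} (he : e ∉ H) :
    (regularWith V r (insert e H)).card * (r * Fintype.card V - r * (S.card + 2 * r + 2)) ≤
      (regularWith V r H).card * r ^ 2 := by
  induction e using Sym2.ind with
  | _ u v =>
  refine le_trans ?_ (sum_card_switches_le hH he)
  rw [← smul_eq_mul]
  refine Finset.card_nsmul_le_sum _ _ _ fun G hG => ?_
  obtain ⟨hdeg, hedges⟩ := mem_regularWith.1 hG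
  exact card_switches_ge hdeg (hedges _ (Finset.mem_insert_self _ _)) S

lemma card_regularWith_le {S : Finset V} {H : Finset (Sym2 V)} (hH : ∀ e ∈ H, ∀ x ∈ e, x ∈ S) :
    (regularWith V r H).card * (r * Fintype.card V - r * (S.card + 2 * r + 2)) ^ H.card ≤
      (regularWith V r ∅).card * (r ^ 2) ^ H.card := by
  classical
  induction H using Finset.induction_on with
  | empty => simp
  | insert e H he ih =>
    have hH' := fun e he => hH e (Finset.mem_insert_of_mem he)
    rw [Finset.card_insert_of_notMem he, pow_succ', pow_succ, ← mul_assoc, ← mul_assoc]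
    set M := r * Fintype.card V - r * (S.card + 2 * r + 2)
    calc (regularWith V r (insert e H)).card * M * M ^ H.card
        ≤ (regularWith V r H).card * r ^ 2 * M ^ H.card :=
          Nat.mul_le_mul_right _ (card_regularWith_insert hH' he)
      _ = (regularWith V r H).card * M ^ H.card * r ^ 2 := mul_right_comm _ _ _
      _ ≤ (regularWith V r ∅).card * (r ^ 2) ^ H.card * r ^ 2 := Nat.mul_le_mul_right _ (ih hH')

end

section

variable {V : Type*} [Fintype V] {r k m : ℕ}

lemma card_regularWith_mul_pow_le (hr : 0 < r) {S : Finset V}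
    (hn : 2 * (S.card + 2 * r + 2) ≤ Fintype.card V) {H : Finset (Sym2 V)}
    (hH : ∀ e ∈ H, ∀ x ∈ e, x ∈ S) :
    (regularWith V r H).card * Fintype.card V ^ H.card ≤
      (regularWith V r ∅).card * (2 * r) ^ H.card := by
  set M := r * Fintype.card V - r * (S.card + 2 * r + 2)
  have hhalf : r * Fintype.card V ≤ 2 * M := by
    have hmul := Nat.mul_le_mul_left r hn
    rw [mul_left_comm] at hmul
    lia
  refine Nat.le_of_mul_le_mul_right ?_ (Nat.pow_pos hr : 0 < r ^ H.card)
  calc (regularWith V r H).card * Fintype.card V ^ H.card * r ^ H.card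
      = (regularWith V r H).card * (r * Fintype.card V) ^ H.card := by rw [mul_pow]; ring
    _ ≤ (regularWith V r H).card * (2 * M) ^ H.card := by gcongr
    _ = (regularWith V r H).card * M ^ H.card * 2 ^ H.card := by rw [mul_pow]; ring
    _ ≤ (regularWith V r ∅).card * (r ^ 2) ^ H.card * 2 ^ H.card :=
        Nat.mul_le_mul_right _ (card_regularWith_le hH)
    _ = (regularWith V r ∅).card * (2 * r) ^ H.card * r ^ H.card := by rw [sq]; ring

/-- The pairs of a set of `m` vertices and a set of `m` edges between them: the possible witnesses
for a bad vertex. -/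
def densePairs (V : Type*) [Fintype V] (m : ℕ) : Finset ((_ : Finset V) × Finset (Sym2 V)) :=
  (Finset.univ.powersetCard m).sigma fun S => S.sym2.powersetCard m

lemma mem_densePairs {P : (_ : Finset V) × Finset (Sym2 V)} :
    P ∈ densePairs V m ↔ P.1.card = m ∧ (∀ e ∈ P.2, ∀ x ∈ e, x ∈ P.1) ∧ P.2.card = m := by
  simp only [densePairs, Finset.mem_sigma, Finset.mem_powersetCard, Finset.subset_univ, true_and,
    Finset.subset_iff (s₁ := P.2), Finset.mem_sym2_iff]

lemma card_densePairs_le : (densePairs V m).card ≤ Fintype.card V ^ m * 2 ^ (m + 1).choose 2 := by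
  have hedges : ∀ S ∈ (Finset.univ : Finset V).powersetCard m,
      (S.sym2.powersetCard m).card ≤ 2 ^ (m + 1).choose 2 := fun S hS => by
    calc (S.sym2.powersetCard m).card ≤ S.sym2.powerset.card :=
          Finset.card_le_card fun _ hE => Finset.mem_powerset.2 (Finset.mem_powersetCard.1 hE).1
      _ = 2 ^ (m + 1).choose 2 := by
          rw [Finset.card_powerset, Finset.card_sym2, (Finset.mem_powersetCard.1 hS).2]
  calc (densePairs V m).card ≤ ((Finset.univ : Finset V).powersetCard m).card •
        2 ^ (m + 1).choose 2 := by
        rw [densePairs, Finset.card_sigma]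
        exact Finset.sum_le_card_nsmul _ _ _ hedges
    _ ≤ Fintype.card V ^ m * 2 ^ (m + 1).choose 2 := by
        rw [smul_eq_mul, Finset.card_powersetCard, Finset.card_univ]
        exact Nat.mul_le_mul_right _ (Nat.choose_le_pow _ _)

lemma sum_card_regularWith_le (hr : 0 < r) (hn : 2 * (m + 2 * r + 2) ≤ Fintype.card V) :
    ∑ P ∈ densePairs V m, (regularWith V r P.2).card ≤
      2 ^ (m + 1).choose 2 * (2 * r) ^ m * (regularWith V r ∅).card := by
  refine Nat.le_of_mul_le_mul_right ?_ (Nat.pow_pos (by lia) : 0 < Fintype.card V ^ m)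
  calc (∑ P ∈ densePairs V m, (regularWith V r P.2).card) * Fintype.card V ^ m
      = ∑ P ∈ densePairs V m, (regularWith V r P.2).card * Fintype.card V ^ m :=
        Finset.sum_mul _ _ _
    _ ≤ (densePairs V m).card • ((regularWith V r ∅).card * (2 * r) ^ m) := by
        refine Finset.sum_le_card_nsmul _ _ _ fun P hP => ?_
        obtain ⟨hS, hedges, hE⟩ := mem_densePairs.1 hP
        exact hE ▸ card_regularWith_mul_pow_le hr (hS.symm ▸ hn) hedges
    _ ≤ Fintype.card V ^ m * 2 ^ (m + 1).choose 2 * ((regularWith V r ∅).card * (2 * r) ^ m) :=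
        Nat.mul_le_mul_right _ card_densePairs_le
    _ = 2 ^ (m + 1).choose 2 * (2 * r) ^ m * (regularWith V r ∅).card * Fintype.card V ^ m := by
        ring

open Classical in
lemma card_regularWith_eq_sum (H : Finset (Sym2 V)) : (regularWith V r H).card =
    ∑ G ∈ regularWith V r ∅, if ∀ e ∈ H, e ∈ G.edgeSet then 1 else 0 := by
  rw [← Finset.card_filter]
  congr 1
  ext G
  simp [mem_regularWith]

open Classical in
lemma ncard_badVertices_le (G : SimpleGraph V) (k : ℕ) :
    (badVertices G k).ncard ≤ ∑ m ∈ Finset.range (k + 1),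
      ((densePairs V m).filter fun P => ∀ e ∈ P.2, e ∈ G.edgeSet).card * m := by
  set witnesses := fun m => (densePairs V m).filter fun P => ∀ e ∈ P.2, e ∈ G.edgeSet
  have hcover : badVertices G k ⊆
      ((Finset.range (k + 1)).biUnion fun m => (witnesses m).biUnion Sigma.fst : Finset V) := by
    rintro v ⟨S, hv, hS, E, hE, hedges⟩
    refine Finset.mem_biUnion.2 ⟨S.card, Finset.mem_range_succ_iff.2 hS,
      Finset.mem_biUnion.2 ⟨⟨S, E⟩, Finset.mem_filter.2 ⟨mem_densePairs.2 ?_, ?_⟩, hv⟩⟩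
    · exact ⟨rfl, fun e he => (hedges e he).2, hE⟩
    · exact fun e he => (hedges e he).1
  calc (badVertices G k).ncard
      ≤ ((Finset.range (k + 1)).biUnion fun m => (witnesses m).biUnion Sigma.fst).card :=
        (Set.ncard_le_ncard hcover).trans_eq (Set.ncard_coe_finset _)
    _ ≤ ∑ m ∈ Finset.range (k + 1), ((witnesses m).biUnion Sigma.fst).card :=
        Finset.card_biUnion_le
    _ ≤ ∑ m ∈ Finset.range (k + 1), (witnesses m).card * m :=
        Finset.sum_le_sum fun m _ => Finset.card_biUnion_le_card_mul _ _ _ fun P hP =>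
          (mem_densePairs.1 (Finset.mem_filter.1 hP).1).1.le

/-- The constant in the bound for the mean number of bad vertices of a random regular graph. -/
def badConst (r k : ℕ) : ℕ :=
  ∑ m ∈ Finset.range (k + 1), 2 ^ (m + 1).choose 2 * (2 * r) ^ m * m

theorem sum_ncard_badVertices_le (hr : 0 < r) (hn : 2 * (k + 2 * r + 2) ≤ Fintype.card V) :
    ∑ G ∈ regularWith V r ∅, (badVertices G k).ncard ≤
      badConst r k * (regularWith V r ∅).card := by
  classical
  calc ∑ G ∈ regularWith V r ∅, (badVertices G k).ncard
      ≤ ∑ G ∈ regularWith V r ∅, ∑ m ∈ Finset.range (k + 1),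
          ((densePairs V m).filter fun P => ∀ e ∈ P.2, e ∈ G.edgeSet).card * m :=
        Finset.sum_le_sum fun G _ => ncard_badVertices_le G k
    _ = ∑ m ∈ Finset.range (k + 1),
          (∑ P ∈ densePairs V m, (regularWith V r P.2).card) * m := by
        rw [Finset.sum_comm]
        refine Finset.sum_congr rfl fun m _ => ?_
        rw [← Finset.sum_mul]
        congr 1
        simp only [card_regularWith_eq_sum, Finset.card_filter]
        exact Finset.sum_comm
    _ ≤ ∑ m ∈ Finset.range (k + 1),
          2 ^ (m + 1).choose 2 * (2 * r) ^ m * (regularWith V r ∅).card * m :=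
        Finset.sum_le_sum fun m hm => Nat.mul_le_mul_right _ (sum_card_regularWith_le hr
          (by have := Finset.mem_range.1 hm; lia))
    _ = badConst r k * (regularWith V r ∅).card := by
        rw [badConst, Finset.sum_mul]
        exact Finset.sum_congr rfl fun m _ => mul_right_comm _ _ _

end

lemma ncard_neighborSet_circulantGraph {A : Type*} [AddGroup A] {s : Set A} (h0 : 0 ∉ s)
    (hneg : ∀ x ∈ s, -x ∈ s) (a : A) :
    ((SimpleGraph.circulantGraph s).neighborSet a).ncard = s.ncard := by
  have hnbr : (SimpleGraph.circulantGraph s).neighborSet a = (· + a) '' s := by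
    ext b
    have hsub : b - a ∈ s → a - b ∈ s ∧ a ≠ b := fun hb =>
      ⟨neg_sub b a ▸ hneg _ hb, fun hab => h0 (by simpa [hab] using hb)⟩
    have hsub' : a - b ∈ s → b - a ∈ s := fun hb => neg_sub a b ▸ hneg _ hb
    simp only [SimpleGraph.mem_neighborSet, SimpleGraph.circulantGraph_adj, Set.image_add_right,
      Set.mem_preimage, ← sub_eq_add_neg]
    tauto
  rw [hnbr, Set.ncard_image_of_injective _ (add_left_injective a)]

lemma exists_neg_ne_self {n : ℕ} [NeZero n] {A : Finset (ZMod n)} (h0 : 0 ∈ A)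
    (hcard : A.card + 1 < n) : ∃ z ∉ A, -z ≠ z := by
  by_contra! hfix
  have hval : ∀ z ∉ A, 2 * z.val = n := fun z hz =>
    ((ZMod.neg_eq_self_iff z).1 (hfix z hz)).resolve_left fun h => hz (h ▸ h0)
  have hcompl : Aᶜ.card ≤ 1 := Finset.card_le_one.2 fun x hx y hy => ZMod.val_injective n <| by
    have := hval x (Finset.mem_compl.1 hx)
    have := hval y (Finset.mem_compl.1 hy)
    lia
  rw [Finset.card_compl, ZMod.card] at hcompl
  lia

lemma exists_symmetric_finset (n : ℕ) [NeZero n] (r : ℕ) : r < n → Even (r * n) →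
    ∃ A : Finset (ZMod n), A.card = r ∧ 0 ∉ A ∧ ∀ x ∈ A, -x ∈ A := by
  induction r using Nat.twoStepInduction with
  | zero => exact fun _ _ => ⟨∅, by simp⟩
  | one =>
    intro hn he
    obtain ⟨m, hm⟩ := one_mul n ▸ he
    have hm0 : (m : ZMod n) ≠ 0 := fun h =>
      Nat.not_dvd_of_pos_of_lt (by lia) (by lia) ((ZMod.natCast_eq_zero_iff m n).1 h)
    have hneg : -(m : ZMod n) = m := by
      rw [neg_eq_iff_add_eq_zero, ← Nat.cast_add, ← hm, ZMod.natCast_self]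
    exact ⟨{(m : ZMod n)}, Finset.card_singleton _, by simpa using hm0.symm, by simp [hneg]⟩
  | more r ih _ =>
    intro hn he
    obtain ⟨A, hA, h0, hsymm⟩ := ih (by lia)
      ((Nat.even_add.1 (add_mul r 2 n ▸ he)).2 (even_two_mul n))
    obtain ⟨z, hz, hzneg⟩ := exists_neg_ne_self (Finset.mem_insert_self 0 A)
      (by rw [Finset.card_insert_of_notMem h0]; lia)
    rw [Finset.mem_insert, not_or] at hz
    have hnegz : -z ∉ A := fun h => hz.2 (neg_neg z ▸ hsymm _ h)
    refine ⟨insert z (insert (-z) A), ?_, ?_, ?_⟩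
    · rw [Finset.card_insert_of_notMem (by simp [hzneg.symm, hz.2]),
        Finset.card_insert_of_notMem hnegz, hA]
    · simp [h0, eq_comm, hz.1]
    · intro x hx
      simp only [Finset.mem_insert] at hx ⊢
      rcases hx with rfl | rfl | hx
      · exact Or.inr (Or.inl rfl)
      · exact Or.inl (neg_neg z)
      · exact Or.inr (Or.inr (hsymm x hx))

lemma regularWith_nonempty {n r : ℕ} (hrn : r < n) (he : Even (r * n)) :
    (regularWith (Fin n) r ∅).Nonempty := by
  obtain ⟨m, rfl⟩ := Nat.exists_eq_add_of_lt hrn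
  obtain ⟨A, hA, h0, hneg⟩ := exists_symmetric_finset (r + m + 1) r hrn he
  refine ⟨SimpleGraph.circulantGraph (A : Set (ZMod (r + m + 1))), mem_regularWith.2
    ⟨fun a => ?_, by simp⟩⟩
  exact (ncard_neighborSet_circulantGraph h0 hneg a).trans ((Set.ncard_coe_finset A).trans hA)

lemma coe_regularWith (n r : ℕ) : (regularWith (Fin n) r ∅ : Set (SimpleGraph (Fin n))) =
    regularGraphs r n := by
  ext G
  simp only [Finset.mem_coe, mem_regularWith, Finset.notMem_empty, false_imp_iff, implies_true,
    and_true, regularGraphs, Set.mem_ofPred_eq, SimpleGraph.IsRegularOfDegree]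
  refine forall_congr' fun a => ?_
  rw [← SimpleGraph.card_neighborFinset_eq_degree, ← Set.ncard_coe_finset,
    SimpleGraph.coe_neighborFinset]

open Classical in
lemma regularProb_eq (r n : ℕ) (A : Set (SimpleGraph (Fin n))) : regularProb r n A =
    ((regularWith (Fin n) r ∅).filter (· ∈ A)).card / (regularWith (Fin n) r ∅).card := by
  rw [regularProb, ← coe_regularWith, Set.ncard_coe_finset,
    ← Set.ncard_coe_finset (Finset.filter ..), Finset.coe_filter]
  rfl

lemma regularProb_le_one (r n : ℕ) (A : Set (SimpleGraph (Fin n))) : regularProb r n A ≤ 1 :=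
  div_le_one_of_le₀ (Nat.cast_le.2 (Set.ncard_le_ncard Set.inter_subset_left (Set.toFinite _)))
    (Nat.cast_nonneg _)

section

variable {r k n : ℕ} {δ : ℝ}

open Classical in
lemma card_notMem_mul_le (hr : 0 < r) (hn : 2 * (k + 2 * r + 2) ≤ n)
    {A : Set (SimpleGraph (Fin n))} (hA : ∀ G : SimpleGraph (Fin n),
      (∀ y, (G.neighborSet y).ncard = r) → ((badVertices G k).ncard : ℝ) ≤ δ * n → G ∈ A) :
    ((regularWith (Fin n) r ∅).filter (· ∉ A)).card * (δ * n) ≤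
      badConst r k * (regularWith (Fin n) r ∅).card := by
  have hmany : ∀ G ∈ (regularWith (Fin n) r ∅).filter (· ∉ A),
      δ * n ≤ (badVertices G k).ncard := fun G hG => by
    obtain ⟨hreg, hGA⟩ := Finset.mem_filter.1 hG
    exact (lt_of_not_ge fun hle => hGA (hA G (mem_regularWith.1 hreg).1 hle)).le
  calc ((regularWith (Fin n) r ∅).filter (· ∉ A)).card * (δ * n)
      ≤ ∑ G ∈ (regularWith (Fin n) r ∅).filter (· ∉ A), ((badVertices G k).ncard : ℝ) := by
        rw [← nsmul_eq_mul]
        exact Finset.card_nsmul_le_sum _ _ _ hmany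
    _ ≤ ∑ G ∈ regularWith (Fin n) r ∅, ((badVertices G k).ncard : ℝ) :=
        Finset.sum_le_sum_of_subset_of_nonneg (Finset.filter_subset _ _) fun _ _ _ =>
          Nat.cast_nonneg _
    _ ≤ badConst r k * (regularWith (Fin n) r ∅).card := by
        exact_mod_cast sum_ncard_badVertices_le hr (V := Fin n) (by simpa using hn)

lemma regularProb_ge (hr : 0 < r) (hδ : 0 < δ) (hn : 2 * (k + 2 * r + 2) ≤ n)
    (he : Even (r * n)) {A : Set (SimpleGraph (Fin n))} (hA : ∀ G : SimpleGraph (Fin n),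
      (∀ y, (G.neighborSet y).ncard = r) → ((badVertices G k).ncard : ℝ) ≤ δ * n → G ∈ A) :
    1 - badConst r k / δ * (1 / (n : ℝ)) ≤ regularProb r n A := by
  classical
  have hcard : (0 : ℝ) < (regularWith (Fin n) r ∅).card :=
    Nat.cast_pos.2 (Finset.card_pos.2 (regularWith_nonempty (by lia) he))
  have hn0 : (0 : ℝ) < n := Nat.cast_pos.2 (by lia)
  have hsplit : (((regularWith (Fin n) r ∅).filter (· ∈ A)).card : ℝ) +
      ((regularWith (Fin n) r ∅).filter (· ∉ A)).card = (regularWith (Fin n) r ∅).card := by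
    exact_mod_cast Finset.card_filter_add_card_filter_not (· ∈ A)
  have hmarkov := (le_div_iff₀ (by positivity)).2 (card_notMem_mul_le hr hn hA)
  rw [regularProb_eq, le_div_iff₀ hcard]
  calc (1 - badConst r k / δ * (1 / (n : ℝ))) * (regularWith (Fin n) r ∅).card
      = (regularWith (Fin n) r ∅).card -
          badConst r k * (regularWith (Fin n) r ∅).card / (δ * n) := by field_simp
    _ ≤ ((regularWith (Fin n) r ∅).filter (· ∈ A)).card := by linarith

theorem aas_of_badVertices (hr : 0 < r) (hδ : 0 < δ) {A : (n : ℕ) → Set (SimpleGraph (Fin n))}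
    (hA : ∀ n (G : SimpleGraph (Fin n)), (∀ y, (G.neighborSet y).ncard = r) →
      ((badVertices G k).ncard : ℝ) ≤ δ * n → G ∈ A n) : AAS r A := by
  have hlim : Tendsto (fun n : ℕ => 1 - badConst r k / δ * (1 / (n : ℝ))) atTop (𝓝 1) := by
    simpa using (tendsto_one_div_atTop_nhds_zero_nat.const_mul (badConst r k / δ)).const_sub 1
  refine tendsto_of_tendsto_of_tendsto_of_le_of_le' (hlim.mono_left inf_le_left)
    tendsto_const_nhds ?_ (Eventually.of_forall fun n => regularProb_le_one r n (A n))
  rw [eventually_inf_principal]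
  filter_upwards [eventually_ge_atTop (2 * (k + 2 * r + 2))] with n hn he
  exact regularProb_ge hr hδ hn he (hA n)

end

end InducedForest

end

theorem corollary1p2 (r : ℕ) (hr : 3 ≤ r) :
    -- the constants `ξ(r, p₀)` and their supremum `ξ(r)` are well defined
    (∀ p₀ ∈ Set.Ioo (0 : ℝ) 1, ∃! v : ℝ, InducedForest.IsXi r p₀ v) ∧
    IsLUB (InducedForest.xiValues r) (InducedForest.xi r) ∧
    -- `ξ(r)` is at least the tabulated value
    (r ≤ 10 → InducedForest.xiTable r ≤ InducedForest.xi r) ∧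
    -- a random `r`-regular graph a.a.s. has an induced forest on `(ξ(r) - ε) n` vertices
    (∀ ε : ℝ, 0 < ε →
      InducedForest.AAS r
        (fun n => {G | InducedForest.HasInducedForest G ((InducedForest.xi r - ε) * n)})) := by
  refine ⟨fun p hp => InducedForest.existsUnique_isXi hr hp.1 hp.2, InducedForest.isLUB_xi hr,
    fun h => InducedForest.xiTable_le_xi hr h, fun ε hε => ?_⟩
  obtain ⟨v, hv, hlt, -⟩ := (InducedForest.isLUB_xi hr).exists_between
    (sub_lt_self (InducedForest.xi r) (half_pos hε))
  obtain ⟨p, α, hp0, hp, hα, rfl⟩ := (InducedForest.mem_xiValues_iff hr).1 hv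
  obtain ⟨k, hk⟩ := InducedForest.exists_large_forest hα hr hp0 hp (show 0 < ε / 10 by positivity)
  refine InducedForest.aas_of_badVertices (k := k) (by lia) (show 0 < ε / 10 by positivity)
    fun n G hdeg hbad => ?_
  obtain ⟨S, hS, hcard⟩ := hk n G hdeg hbad
  refine ⟨S, hS, le_trans ?_ hcard⟩
  exact mul_le_mul_of_nonneg_right (by linarith) (Nat.cast_nonneg n)
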